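/- Let $\Lambda\subset\mathbb{R}^d$ be bounded (and measurable), $\mathbb{K}=\mathbb{R}$ or $\mathbb{C}$, and $\mathscr{H}=L^2(\Lambda)\otimes\mathbb{K}^N$ with norm $\|\cdot\|_2$ and inner product linear in the second argument. Let $C=\sum_n\mu_n|\mu_n\rangle\langle\mu_n|$ be a bounded operator on $\mathscr{H}$, where $(|\mu_n\rangle)$ is an orthonormal basis and $\mu_n>0$ for all $n$. Let $O$ be a Hermitian operator from a test space $\Phi$ with $C^{1/2}\mathscr{H}\subset\Phi\subset\mathscr{H}$ to the space of conjugate-linear functionals on $\Phi$, such that $M=C^{1/2}OC^{1/2}$ is a bounded operator on $\mathscr{H}$, i.e. $\langle x|M|y\rangle=\langle C^{1/2}x|O|C^{1/2}y\rangle$ for all $x,y\in\mathscr{H}$. Assume that $C$ and $M$ are trace class, and let $(e_n)$ be an orthonormal basis of eigenvectors of $M$, $Me_n=\lambda_ne_n$. Let $\varphi$ be a zero-mean Gaussian random element of $\mathscr{H}$ with covariance operator $C$ on a probability space $(\Omega,\mathbb{P})$ (if $\mathbb{K}=\mathbb{C}$, circular: $\mathbb{E}\langle h|\varphi\rangle^2=0$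 and $\mathbb{E}|\langle h|\varphi\rangle|^2=\langle h|C|h\rangle$ for all $h\in\mathscr{H}$). Then $\varphi=\sum_n t_nC^{1/2}e_n$ in mean square for some i.i.d. Gaussian variables $t_n$ in $\mathbb{K}$ with $\mathbb{E}t_n=0$, $\mathbb{E}|t_n|^2=1$ (and $\mathbb{E}t_n^2=0$ if $\mathbb{K}=\mathbb{C}$). For any such $(t_n)$, the quadratic form $\langle\varphi|O|\varphi\rangle$, defined as the limit over finite index sets $s$ of $\langle\varphi_s|O|\varphi_s\rangle$ with $\varphi_s=\sum_{n\in s}t_nC^{1/2}e_n$, exists almost surely, and it equals $\langle\varphi|B\varphi\rangle$ almost surely whenever $O$ is given on $\Phi$ by a bounded operator $B$ on $\mathscr{H}$. Fix a sign $\pm$ such that $\pm\lambda_n>0$ for some $n$. Let $E_\pm$ be the set of indices $n$ for which $\pm\lambda_n$ takes its largest value; it is finite and nonempty. Put $\bar\varphi_\pm=\sum_{n\in E_\pm}t_nC^{1/2}e_n$. Then $\mathbb{P}(\pm\langle\varphi|O|\varphi\rangle>u)>0$ for every real $u$, and for every $\varepsilon>0$, $$\lim_{u\to+\infty}\mathbb{P}\left(\left\|\frac{\varphi}{\|\varphi\|_2}-\frac{\bar\varphi_\pm}{\|\bar\varphi_\pm\|_2}\right\|_2>\varepsilon\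 \middle|\ \pm\langle\varphi|O|\varphi\rangle>u\right)=0.$$ -/

import Mathlib

open MeasureTheory ProbabilityTheory Filter Topology
open scoped ENNReal NNReal InnerProductSpace

namespace QuasiDet

/-- The Hilbert space `L²(Λ) ⊗ 𝕜^N` of `N`-component square-integrable `𝕜`-valued fields on `Λ ⊆ ℝ^d`
(`𝕜 = ℝ` or `ℂ`). Its Mathlib inner product is `⟪ψ, φ⟫ = ∑ m, ∫_Λ conj (ψ_m x) * φ_m x dx`. -/
abbrev FieldSpace (𝕜 : Type*) [RCLike 𝕜] {d : ℕ} (Λ : Set (EuclideanSpace ℝ (Fin d))) (N : ℕ) :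
    Type _ :=
  Lp (EuclideanSpace 𝕜 (Fin N)) 2 ((volume : Measure (EuclideanSpace ℝ (Fin d))).restrict Λ)

section Operators

variable {𝕜 : Type*} [RCLike 𝕜] {H : Type*} [NormedAddCommGroup H] [InnerProductSpace 𝕜 H]

/-- `b` is an orthonormal basis of eigenvectors of `T`, with (real) eigenvalues `a`. For a bounded
operator `T` this says `T = ∑ n, a n |b n⟩⟨b n|`. -/
def IsEigenbasis {ι : Type*} (T : H →L[𝕜] H) (b : HilbertBasis ι 𝕜 H) (a : ι → ℝ) : Prop :=
  ∀ n, T (b n) = (a n : 𝕜) • b n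

/-- `T` is trace class: the trace of `|T|` is finite, where `|T|` is the positive operator whose
square is `T† T`. -/
def IsTraceClass [CompleteSpace H] (T : H →L[𝕜] H) : Prop :=
  ∃ A : H →L[𝕜] H, A.IsPositive ∧ A ∘L A = ContinuousLinearMap.adjoint T ∘L T ∧
    ∀ (s : Set H) (b : HilbertBasis s 𝕜 H), Summable fun n => RCLike.re ⟪b n, A (b n)⟫_𝕜

open Classical in
/-- The positive square root `T^{1/2}` of a positive operator `T`. -/
noncomputable def posSqrt (T : H →L[𝕜] H) : H →L[𝕜] H :=
  if h : ∃ R : H →L[𝕜] H, R.IsPositive ∧ R ∘L R = T then h.choose else 0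

/-- A bounded operator that is diagonal in an orthonormal basis with nonnegative eigenvalues has a
positive square root. -/
theorem exists_posSqrt {ι : Type*} [CompleteSpace H] {T : H →L[𝕜] H} {b : HilbertBasis ι 𝕜 H}
    {a : ι → ℝ} (hT : IsEigenbasis T b a) (ha : ∀ n, 0 ≤ a n) :
    ∃ R : H →L[𝕜] H, R.IsPositive ∧ R ∘L R = T := by
  have hb : ∀ n, a n ≤ ‖T‖ := fun n => by
    have h := T.le_opNorm (b n)
    rw [hT n, norm_smul, b.orthonormal.1 n, RCLike.norm_ofReal, abs_of_nonneg (ha n)] at h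
    simpa using h
  let D : ι → 𝕜 →L[𝕜] 𝕜 := fun n => ((√(a n) : ℝ) : 𝕜) • ContinuousLinearMap.id 𝕜 𝕜
  have hD : ∀ n, ‖D n‖ ≤ √‖T‖ := fun n => by
    refine ContinuousLinearMap.opNorm_le_bound _ (Real.sqrt_nonneg _) fun x => ?_
    simp only [D, _root_.smul_apply, ContinuousLinearMap.id_apply, norm_smul,
      RCLike.norm_ofReal, abs_of_nonneg (Real.sqrt_nonneg _)]
    exact mul_le_mul_of_nonneg_right (Real.sqrt_le_sqrt (hb n)) (norm_nonneg x)
  let L := lp.mapCLM 2 D (Real.sqrt_nonneg _) hD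
  let R : H →L[𝕜] H :=
    (b.repr.symm.toContinuousLinearEquiv : _ →L[𝕜] H) ∘L L ∘L
      (b.repr.toContinuousLinearEquiv : H →L[𝕜] _)
  have hR : ∀ x n, b.repr (R x) n = ((√(a n) : ℝ) : 𝕜) * b.repr x n := fun x n => by
    simp [R, L, D, lp.mapCLM]
  have hpos : R.IsPositive := by
    refine ⟨fun x y => ?_, fun x => ?_⟩
    · change ⟪R x, y⟫_𝕜 = ⟪x, R y⟫_𝕜
      rw [← b.repr.inner_map_map, ← b.repr.inner_map_map x, lp.inner_eq_tsum, lp.inner_eq_tsum]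
      refine tsum_congr fun n => ?_
      rw [hR, hR]
      simp only [RCLike.inner_apply, map_mul, RCLike.conj_ofReal]
      ring
    · change 0 ≤ RCLike.re ⟪R x, x⟫_𝕜
      rw [← b.repr.inner_map_map]
      refine (RCLike.hasSum_re _ (lp.hasSum_inner (b.repr (R x)) (b.repr x))).nonneg fun n => ?_
      rw [hR]
      simp only [RCLike.inner_apply, map_mul, RCLike.conj_ofReal]
      rw [mul_left_comm, RCLike.mul_conj, ← RCLike.ofReal_pow, ← RCLike.ofReal_mul, RCLike.ofReal_re]
      positivity
  have hTr : ∀ x n, b.repr (T x) n = ((a n : ℝ) : 𝕜) * b.repr x n := fun x n => by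
    have h1 := (b.hasSum_repr x).mapL T
    have h2 := (h1.mapL (innerSL 𝕜 (b n)))
    rw [b.repr_apply_apply]
    refine h2.unique ?_
    convert! hasSum_single n fun m hm => ?_
    · simp [hT n, b.orthonormal.1 n, mul_comm]
    · simp [hT m, b.orthonormal.2 (Ne.symm hm)]
  refine ⟨R, hpos, ?_⟩
  ext x
  refine b.repr.injective (lp.ext (funext fun n => ?_))
  rw [ContinuousLinearMap.comp_apply, hR, hR, hTr, ← mul_assoc, ← RCLike.ofReal_mul,
    Real.mul_self_sqrt (ha n)]

end Operators

section Fields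

variable (𝕜 : Type*) [RCLike 𝕜]

open Classical in
/-- The variance of the real part of a standard Gaussian variable `t` in `𝕜`, normalised by
`E |t|² = 1`: it is `1` for real variables and `1/2` for (circular) complex ones. -/
noncomputable def reVar : ℝ≥0 := if (RCLike.I : 𝕜) = 0 then 1 else 1 / 2

variable {𝕜} {H : Type*} [NormedAddCommGroup H] [InnerProductSpace 𝕜 H]
  {Ω : Type*} [MeasurableSpace Ω]

/-- `t` is a standard Gaussian variable in `𝕜`: `N(0,1)` if `𝕜 = ℝ`; if `𝕜 = ℂ`, complex Gaussian
with `E t = E t² = 0` and `E |t|² = 1` (equivalently, all `Re (z t)` are `N(0, |z|²/2)`). -/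
def IsStdGaussian (P : Measure Ω) (t : Ω → 𝕜) : Prop :=
  AEMeasurable t P ∧
    ∀ z : 𝕜, P.map (fun ω => RCLike.re (z * t ω)) = gaussianReal 0 (reVar 𝕜 * ‖z‖₊ ^ 2)

/-- `φ` is a zero-mean Gaussian random element of `H` with covariance operator `C`: every `⟪h, φ⟫`
is a centred Gaussian with `E |⟪h, φ⟫|² = ⟪h, C h⟫`, and in the complex case it is circular
(`E ⟪h, φ⟫² = 0`). -/
def IsGaussianField (P : Measure Ω) (C : H →L[𝕜] H) (φ : Ω → H) : Prop :=
  AEStronglyMeasurable φ P ∧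
    ∀ h : H, P.map (fun ω => RCLike.re ⟪h, φ ω⟫_𝕜) =
      gaussianReal 0 (reVar 𝕜 * (RCLike.re ⟪h, C h⟫_𝕜).toNNReal)

/-- `t` is the family of coefficients of the generalized Karhunen-Loève expansion
`φ = ∑ n, t n C^{1/2} ν_n` of `φ` in the orthonormal basis `ν`: the `t n` are i.i.d. standard
Gaussian variables and the series converges to `φ` in mean square. -/
def IsKarhunenLoeve {ι : Type*} (P : Measure Ω) (C : H →L[𝕜] H) (φ : Ω → H)
    (ν : HilbertBasis ι 𝕜 H) (t : ι → Ω → 𝕜) : Prop :=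
  (∀ n, IsStdGaussian P (t n)) ∧ iIndepFun t P ∧
    Tendsto (fun s : Finset ι =>
      eLpNorm (fun ω => φ ω - ∑ n ∈ s, t n ω • posSqrt C (ν n)) 2 P) atTop (𝓝 0)

/-- `O` is a Hermitian operator from the test space `Φ ⊆ H` to the distribution space of
conjugate-linear functionals on `Φ` (in which `H` embeds by `f ↦ ⟪·, f⟫`). The matrix element
`⟨g|O|f⟩` is `O f g`. -/
def IsHermitianForm {Φ : Submodule 𝕜 H} (O : Φ →ₗ[𝕜] (Φ →ₗ⋆[𝕜] 𝕜)) : Prop :=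
  ∀ f g : Φ, O f g = (starRingEnd 𝕜) (O g f)

/-- `M = C^{1/2} O C^{1/2}`, where `C^{1/2}` maps `H` to the test space `Φ` and, by duality,
distributions on `Φ` to `H`: `⟪x, M y⟫ = ⟨C^{1/2} x|O|C^{1/2} y⟩`. -/
def IsSandwich {Φ : Submodule 𝕜 H} (C : H →L[𝕜] H) (hΦ : ∀ x, posSqrt C x ∈ Φ)
    (O : Φ →ₗ[𝕜] (Φ →ₗ⋆[𝕜] 𝕜)) (M : H →L[𝕜] H) : Prop :=
  ∀ x y : H, ⟪x, M y⟫_𝕜 = O ⟨posSqrt C y, hΦ y⟩ ⟨posSqrt C x, hΦ x⟩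

/-- The quadratic form `⟨φ_s|O|φ_s⟩` of the partial sum `φ_s = ∑ n ∈ s, t n C^{1/2} ν_n` of the
expansion of `φ`, which lies in the test space. -/
noncomputable def partialForm {ι : Type*} {Φ : Submodule 𝕜 H} (C : H →L[𝕜] H)
    (hΦ : ∀ x, posSqrt C x ∈ Φ) (O : Φ →ₗ[𝕜] (Φ →ₗ⋆[𝕜] 𝕜)) (ν : HilbertBasis ι 𝕜 H)
    (t : ι → Ω → 𝕜) (s : Finset ι) (ω : Ω) : ℝ :=
  let φs : Φ := ∑ n ∈ s, t n ω • (⟨posSqrt C (ν n), hΦ (ν n)⟩ : Φ)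
  RCLike.re (O φs φs)

/-- The random quadratic form `⟨φ|O|φ⟩`, the limit of `⟨φ_s|O|φ_s⟩` along the partial sums `φ_s` of
the expansion of `φ` (the realizations of `φ` need not lie in the test space themselves). -/
noncomputable def quadForm {ι : Type*} {Φ : Submodule 𝕜 H} (C : H →L[𝕜] H)
    (hΦ : ∀ x, posSqrt C x ∈ Φ) (O : Φ →ₗ[𝕜] (Φ →ₗ⋆[𝕜] 𝕜)) (ν : HilbertBasis ι 𝕜 H)
    (t : ι → Ω → 𝕜) (ω : Ω) : ℝ :=
  limUnder atTop fun s : Finset ι => partialForm C hΦ O ν t s ω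

/-- The indices of the extremal eigenvalue of sign `σ = ±1`: those where `lam` takes its largest
positive value if `σ = 1`, its smallest negative value if `σ = -1`. -/
def extremal {ι : Type*} (lam : ι → ℝ) (σ : ℝ) : Set ι :=
  {i | 0 < σ * lam i ∧ ∀ j, σ * lam j ≤ σ * lam i}

/-- The component `φ̄_± = ∑ t n C^{1/2} e_n`, summed over the indices `n` of the extremal eigenvalue
of sign `σ = ±1`. -/
noncomputable def fieldBar {ι : Type*} (C : H →L[𝕜] H) (e : HilbertBasis ι 𝕜 H) (lam : ι → ℝ)
    (t : ι → Ω → 𝕜) (σ : ℝ) (ω : Ω) : H :=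
  ∑ᶠ n ∈ extremal lam σ, t n ω • posSqrt C (e n)

variable (𝕜) in
/-- `x / ‖x‖`. -/
noncomputable def unitVec (x : H) : H := ((‖x‖⁻¹ : ℝ) : 𝕜) • x

end Fields

end QuasiDet

/-!
Write `R = C^{1/2}`, `a n = σ lam n`, `A = max a > 0`, and let `E` be the (finite) set of indices
where the maximum is attained.

*Expansion.* Since `E |⟪h, φ⟫|² = ‖R h‖²`, the map `R h ↦ ⟪h, φ⟫` extends from the dense range of
`R` to a conjugate-linear map `w` from `H` to `L²(P)` with `w x` Gaussian of variance `‖x‖²`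
(`IsGaussianField.exists_isonormal`). The coefficients are `t n = w (e n)`; mean-square
convergence follows by summing `E |⟪b m, φ - φ_s⟫|²` over the eigenbasis `b` of `C`, whose trace
is finite.

*Quadratic form.* The partial forms are `∑ n ∈ s, lam n |t n|²`, and `∑ |lam n| < ∞` because `M`
is trace class, so they converge almost surely (`ae_hasSum_quadForm`).

*Concentration.* Let `Q = ∑ a n |t n|²`, `S = ∑ n ∈ E, |t n|²`, `φ̄ = ∑ n ∈ E, t n R e_n`, and let
`r` be such that `P (|t|² > v)` decays like `exp (-r v)`. If the directions of `φ` and `φ̄` differ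
by more than `ε`, then `‖φ - φ̄‖² ≥ δ S` for some `δ > 0` depending on `ε`, as `‖φ̄‖²` is bounded
below by a multiple of `S`. On this event `Q > u` implies `Q - ϰ δ S + ϰ ‖φ - φ̄‖² > u`, and for
small `ϰ` the left side has an exponential moment of some order `θ > r / A`: the extremal modes
now enter with the coefficient `A - ϰ δ < A`, the other modes have coefficients bounded away from
`A`, they are independent of the extremal ones, and `‖φ - φ̄‖²` has some exponential moment. Hence
the probability is `O(exp (-θ u))` (`exists_measure_le_exp`). On the other hand `P (Q > u)` is at
least of order `exp (-(1 + η) r u / A)` for every `η > 0`, because a single extremal mode may be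
large while the remainder stays bounded (`exists_le_measure_lt`). The quotient tends to zero.
-/

namespace QuasiDet

/-! ### Scalar Gaussian variables -/

section Scalar

variable {𝕜 : Type*} [RCLike 𝕜] {Ω : Type*} [MeasurableSpace Ω] {P : Measure Ω}

theorem reVar_pos : 0 < reVar 𝕜 := by
  unfold reVar
  split_ifs <;> norm_num

/-- `g` is a centred Gaussian variable in `𝕜` (circular in the complex case) of variance
`E |g|² = v`; the degenerate case `v = 0` is allowed. -/
def IsCenteredGaussian (P : Measure Ω) (g : Ω → 𝕜) (v : ℝ≥0) : Prop :=
  AEMeasurable g P ∧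
    ∀ z : 𝕜, P.map (fun ω => RCLike.re (z * g ω)) = gaussianReal 0 (reVar 𝕜 * ‖z‖₊ ^ 2 * v)

theorem isStdGaussian_iff {g : Ω → 𝕜} : IsStdGaussian P g ↔ IsCenteredGaussian P g 1 := by
  simp [IsStdGaussian, IsCenteredGaussian]

theorem IsCenteredGaussian.congr {g g' : Ω → 𝕜} {v : ℝ≥0} (hg : IsCenteredGaussian P g v)
    (h : g =ᵐ[P] g') : IsCenteredGaussian P g' v := by
  refine ⟨hg.1.congr h, fun z => ?_⟩
  rw [← hg.2 z]
  refine Measure.map_congr ?_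
  filter_upwards [h] with ω hω
  rw [hω]

theorem IsCenteredGaussian.aemeasurable_re {g : Ω → 𝕜} {v : ℝ≥0} (hg : IsCenteredGaussian P g v)
    (z : 𝕜) : AEMeasurable (fun ω => RCLike.re (z * g ω)) P :=
  RCLike.measurable_re.comp_aemeasurable (hg.1.const_mul z)

theorem re_ofReal_sub_mul_I_mul (w₁ w₂ : ℝ) (a : 𝕜) :
    RCLike.re (((w₁ : 𝕜) - (w₂ : 𝕜) * RCLike.I) * a) = w₁ * RCLike.re a + w₂ * RCLike.im a := by
  have h := RCLike.mul_im_I_ax a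
  simp only [RCLike.mul_re, map_sub, RCLike.ofReal_re, RCLike.I_re, mul_zero,
    RCLike.mul_im, RCLike.ofReal_im, zero_mul]
  linear_combination w₂ * h

theorem norm_I_le_one : ‖(RCLike.I : 𝕜)‖ ≤ 1 := by
  rcases RCLike.I_mul_I_ax (K := 𝕜) with h | h
  · simp [h]
  · have h2 : ‖(RCLike.I : 𝕜)‖ * ‖(RCLike.I : 𝕜)‖ = 1 := by rw [← norm_mul, h]; simp
    nlinarith [norm_nonneg (RCLike.I : 𝕜)]

theorem norm_ofReal_sub_mul_I_sq_le (w₁ w₂ : ℝ) :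
    ‖(w₁ : 𝕜) - (w₂ : 𝕜) * RCLike.I‖ ^ 2 ≤ w₁ ^ 2 + w₂ ^ 2 := by
  have hI : (RCLike.im (RCLike.I : 𝕜)) ^ 2 ≤ 1 := by
    rw [← sq_abs]
    exact pow_le_one₀ (abs_nonneg _) ((RCLike.abs_im_le_norm _).trans norm_I_le_one)
  rw [RCLike.norm_sq_eq_def]
  simp only [RCLike.mul_re, map_sub, RCLike.ofReal_re, RCLike.I_re, mul_zero,
    RCLike.mul_im, RCLike.ofReal_im, zero_mul]
  nlinarith [sq_nonneg w₂]

/-- The exponential moment `E exp (x y²)` of a real `N(0, V)` variable `y`. -/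
noncomputable def expSqMoment (V : ℝ≥0) (x : ℝ) : ℝ≥0∞ :=
  ∫⁻ y, ENNReal.ofReal (Real.exp (x * y ^ 2)) ∂gaussianReal 0 V

theorem expSqMoment_lt_top {V : ℝ≥0} (hV : 0 < V) {x : ℝ} (hx : 2 * V * x < 1) :
    expSqMoment V x < ∞ := by
  have hV' : (0 : ℝ) < V := hV
  rw [expSqMoment, gaussianReal_of_var_ne_zero _ hV.ne',
    lintegral_withDensity_eq_lintegral_mul _ (measurable_gaussianPDF _ _) (by fun_prop)]
  have hb : 0 < 1 / (2 * V) - x := by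
    rw [sub_pos, lt_div_iff₀ (by positivity)]
    linarith
  have hint := ((integrable_exp_neg_mul_sq hb).const_mul (√(2 * Real.pi * V))⁻¹).lintegral_lt_top
  refine lt_of_eq_of_lt (lintegral_congr fun y => ?_) hint
  rw [Pi.mul_apply, gaussianPDF, ← ENNReal.ofReal_mul (gaussianPDFReal_nonneg _ _ _),
    gaussianPDFReal, mul_assoc, ← Real.exp_add]
  congr 3
  field_simp
  ring

theorem lintegral_exp_mul_gaussianReal (V : ℝ≥0) (c : ℝ) :
    ∫⁻ y, ENNReal.ofReal (Real.exp (c * y)) ∂gaussianReal 0 V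
      = ENNReal.ofReal (Real.exp (V * c ^ 2 / 2)) := by
  rw [← ofReal_integral_eq_lintegral_ofReal (integrable_exp_mul_gaussianReal c)
    (ae_of_all _ fun _ => (Real.exp_pos _).le)]
  have := mgf_gaussianReal (p := gaussianReal 0 V) (X := id) (by rw [Measure.map_id]) c
  simp only [mgf, id, zero_mul, zero_add] at this
  rw [this]

/-- Uniform exponential moments of `|g|²`. The square is linearised by an auxiliary Gaussian
vector `w`, through `exp (x |a|²) = E exp (c Re (w̄ a))`; the order of integration is then exchanged.
No knowledge of the joint law of `Re g` and `Im g` is needed. -/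
theorem IsCenteredGaussian.lintegral_exp_sq_le [IsProbabilityMeasure P] {g : Ω → 𝕜} {v : ℝ≥0}
    (hg : IsCenteredGaussian P g v) {x x₀ : ℝ} (hx : 0 ≤ x) (hxv : x * v ≤ x₀) :
    ∫⁻ ω, ENNReal.ofReal (Real.exp (x * ‖g ω‖ ^ 2)) ∂P ≤ expSqMoment (reVar 𝕜) x₀ ^ 2 := by
  have hr : (0 : ℝ) < reVar 𝕜 := reVar_pos (𝕜 := 𝕜)
  set c := √(2 * x / reVar 𝕜) with hc
  have hc2 : c ^ 2 = 2 * x / reVar 𝕜 := Real.sq_sqrt (by positivity)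
  set N := gaussianReal 0 (reVar 𝕜)
  have key : ∀ a : 𝕜, ENNReal.ofReal (Real.exp (x * ‖a‖ ^ 2)) = ∫⁻ w : ℝ × ℝ,
      ENNReal.ofReal (Real.exp (c * (w.1 * RCLike.re a + w.2 * RCLike.im a))) ∂(N.prod N) := by
    intro a
    have e1 : ∀ w : ℝ × ℝ,
        ENNReal.ofReal (Real.exp (c * (w.1 * RCLike.re a + w.2 * RCLike.im a))) =
        ENNReal.ofReal (Real.exp (c * RCLike.re a * w.1)) *
        ENNReal.ofReal (Real.exp (c * RCLike.im a * w.2)) := fun w => by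
      rw [← ENNReal.ofReal_mul (Real.exp_pos _).le, ← Real.exp_add]
      ring_nf
    rw [lintegral_congr e1, lintegral_prod_mul
        (f := fun y : ℝ => ENNReal.ofReal (Real.exp (c * RCLike.re a * y)))
        (g := fun y : ℝ => ENNReal.ofReal (Real.exp (c * RCLike.im a * y)))
        (by fun_prop) (by fun_prop), lintegral_exp_mul_gaussianReal, lintegral_exp_mul_gaussianReal,
      ← ENNReal.ofReal_mul (Real.exp_pos _).le, ← Real.exp_add, RCLike.norm_sq_eq_def]
    congr 2
    rw [mul_pow, mul_pow, hc2]
    field_simp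
  rw [lintegral_congr fun ω => key (g ω)]
  have hmeas : AEMeasurable (Function.uncurry fun (ω : Ω) (w : ℝ × ℝ) =>
      ENNReal.ofReal (Real.exp (c * (w.1 * RCLike.re (g ω) + w.2 * RCLike.im (g ω)))))
      (P.prod (N.prod N)) := by
    have h1 : AEMeasurable (fun p : Ω × ℝ × ℝ => g p.1) (P.prod (N.prod N)) := hg.1.comp_fst
    have h2 := RCLike.measurable_re.comp_aemeasurable h1
    have h3 := RCLike.measurable_im.comp_aemeasurable h1
    simp only [Function.comp_def] at h2 h3
    refine (Real.measurable_exp.comp_aemeasurable ?_).ennreal_ofReal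
    refine ((((measurable_fst.comp measurable_snd).aemeasurable).mul h2).add
      (((measurable_snd.comp measurable_snd).aemeasurable).mul h3)).const_mul c
  rw [lintegral_lintegral_swap hmeas]
  have inner : ∀ w : ℝ × ℝ, ∫⁻ ω, ENNReal.ofReal
      (Real.exp (c * (w.1 * RCLike.re (g ω) + w.2 * RCLike.im (g ω)))) ∂P ≤
      ENNReal.ofReal (Real.exp (x₀ * w.1 ^ 2)) * ENNReal.ofReal (Real.exp (x₀ * w.2 ^ 2)) := by
    intro w
    set z : 𝕜 := (w.1 : 𝕜) - (w.2 : 𝕜) * RCLike.I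
    simp_rw [← re_ofReal_sub_mul_I_mul]
    have := lintegral_map' (μ := P) (f := fun y : ℝ => ENNReal.ofReal (Real.exp (c * y)))
      (by fun_prop) (hg.aemeasurable_re z)
    rw [← this, hg.2 z, lintegral_exp_mul_gaussianReal,
      ← ENNReal.ofReal_mul (Real.exp_pos _).le, ← Real.exp_add]
    refine ENNReal.ofReal_le_ofReal (Real.exp_le_exp.2 ?_)
    rw [hc2]
    push_cast
    have h1 : (reVar 𝕜 : ℝ) * ‖z‖ ^ 2 * v * (2 * x / reVar 𝕜) / 2 = x * v * ‖z‖ ^ 2 := by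
      field_simp
    have h2 : ‖z‖ ^ 2 ≤ w.1 ^ 2 + w.2 ^ 2 :=
      norm_ofReal_sub_mul_I_sq_le _ _
    rw [h1, ← mul_add]
    have h0 : 0 ≤ x * v := by positivity
    exact mul_le_mul hxv h2 (by positivity) (h0.trans hxv)
  refine (lintegral_mono inner).trans_eq ?_
  rw [lintegral_prod_mul (f := fun y : ℝ => ENNReal.ofReal (Real.exp (x₀ * y ^ 2)))
    (g := fun y : ℝ => ENNReal.ofReal (Real.exp (x₀ * y ^ 2))) (by fun_prop) (by fun_prop), sq]
  rfl

theorem lintegral_sq_gaussianReal (V : ℝ≥0) :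
    ∫⁻ y, ENNReal.ofReal (y ^ 2) ∂gaussianReal 0 V = V := by
  have h := variance_id_gaussianReal (μ := 0) (v := V)
  rw [variance_eq_integral (by fun_prop)] at h
  simp only [id, integral_id_gaussianReal, sub_zero] at h
  have hint : Integrable (fun y : ℝ => y ^ 2) (gaussianReal 0 V) := by
    simpa using (memLp_id_gaussianReal (μ := 0) (v := V) 2).integrable_sq
  rw [← ofReal_integral_eq_lintegral_ofReal hint (ae_of_all _ fun _ => sq_nonneg _), h]
  simp

theorem IsCenteredGaussian.lintegral_norm_sq_le {g : Ω → 𝕜} {v : ℝ≥0}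
    (hg : IsCenteredGaussian P g v) :
    ∫⁻ ω, ENNReal.ofReal (‖g ω‖ ^ 2) ∂P ≤ 2 * v := by
  have hr : reVar 𝕜 ≤ 1 := by
    unfold reVar
    split_ifs
    · exact le_rfl
    · rw [div_le_one two_pos]; exact one_le_two
  have hz : ∀ z : 𝕜, ‖z‖ ≤ 1 → ∫⁻ ω, ENNReal.ofReal (RCLike.re (z * g ω) ^ 2) ∂P ≤ v := by
    intro z hz
    have := lintegral_map' (μ := P) (f := fun y : ℝ => ENNReal.ofReal (y ^ 2))
      (by fun_prop) (hg.aemeasurable_re z)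
    rw [← this, hg.2 z, lintegral_sq_gaussianReal]
    have hz' : ‖z‖₊ ^ 2 ≤ 1 := pow_le_one₀ zero_le (by exact_mod_cast hz)
    have : reVar 𝕜 * ‖z‖₊ ^ 2 * v ≤ 1 * 1 * v := by gcongr
    rw [one_mul, one_mul] at this
    exact_mod_cast this
  have h1 := hz 1 (by simp)
  have h2 := hz (-RCLike.I) (by
    rw [norm_neg]
    exact norm_I_le_one)
  calc ∫⁻ ω, ENNReal.ofReal (‖g ω‖ ^ 2) ∂P
      = ∫⁻ ω, (ENNReal.ofReal (RCLike.re ((1 : 𝕜) * g ω) ^ 2) +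
          ENNReal.ofReal (RCLike.re (-RCLike.I * g ω) ^ 2)) ∂P := by
        refine lintegral_congr fun ω => ?_
        rw [← ENNReal.ofReal_add (sq_nonneg _) (sq_nonneg _), RCLike.norm_sq_eq_def]
        congr 1
        have h := RCLike.mul_im_I_ax (g ω)
        simp only [one_mul, neg_mul, map_neg, RCLike.mul_re, RCLike.I_re, zero_mul, zero_sub,
          neg_neg]
        rw [mul_comm (RCLike.im (RCLike.I : 𝕜)), h]
        ring
    _ ≤ v + v := by
        rw [lintegral_add_left' ((hg.aemeasurable_re 1).pow_const 2).ennreal_ofReal]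
        exact add_le_add h1 h2
    _ = 2 * v := (two_mul _).symm

theorem isCenteredGaussian_sum {ι : Type*} [IsProbabilityMeasure P] {t : ι → Ω → 𝕜}
    (ht : ∀ n, IsStdGaussian P (t n)) (hi : iIndepFun t P) (z : ι → 𝕜) (s : Finset ι) :
    IsCenteredGaussian P (fun ω => ∑ n ∈ s, z n * t n ω) (∑ n ∈ s, ‖z n‖₊ ^ 2) := by
  classical
  refine ⟨Finset.aemeasurable_fun_sum _ fun n _ => (ht n).1.const_mul _, fun w => ?_⟩
  have hX : ∀ n, AEMeasurable (fun ω => RCLike.re (w * z n * t n ω)) P := fun n =>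
    RCLike.measurable_re.comp_aemeasurable ((ht n).1.const_mul _)
  have hind : iIndepFun (fun n ω => RCLike.re (w * z n * t n ω)) P :=
    hi.comp (fun n a => RCLike.re (w * z n * a))
      fun n => RCLike.measurable_re.comp (measurable_const_mul _)
  have hsum : P.map (∑ n ∈ s, fun ω => RCLike.re (w * z n * t n ω)) =
      gaussianReal 0 (∑ n ∈ s, reVar 𝕜 * ‖w * z n‖₊ ^ 2) := by
    induction s using Finset.induction_on with
    | empty =>
      simp only [Finset.sum_empty, gaussianReal_zero_var]
      exact (Measure.map_const P (0 : ℝ)).trans (by simp)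
    | insert a s ha ih =>
      have := gaussianReal_add_gaussianReal_of_indepFun
        (hind.indepFun_finsetSum_of_notMem₀ hX ha).symm ((ht a).2 (w * z a)) ih
      rw [Finset.sum_insert ha, Finset.sum_insert ha, this, add_zero]
  convert hsum using 2
  · ext ω
    rw [Finset.sum_apply, Finset.mul_sum, map_sum]
    simp_rw [mul_assoc]
  · rw [Finset.mul_sum]
    refine Finset.sum_congr rfl fun n _ => ?_
    rw [nnnorm_mul]
    ring

/-- Variables all of whose finite linear combinations are Gaussian with the variance that they would
have for independent standard variables are indeed independent: their joint characteristic function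
factorises. -/
theorem iIndepFun_of_isCenteredGaussian_sum {ι : Type*} [IsProbabilityMeasure P] {t : ι → Ω → 𝕜}
    (ht : ∀ n, AEMeasurable (t n) P)
    (h : ∀ (s : Finset ι) (z : ι → 𝕜),
      P.map (fun ω => RCLike.re (∑ n ∈ s, z n * t n ω)) =
        gaussianReal 0 (∑ n ∈ s, reVar 𝕜 * ‖z n‖₊ ^ 2)) :
    iIndepFun t P := by
  classical
  rw [iIndepFun_iff_finset]
  intro s
  rw [iIndepFun_iff_charFunDual_pi (ι := s) (X := s.restrict t) fun i => ht i]
  intro L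
  have hm : AEMeasurable (fun ω (x : s) => s.restrict t x ω) P :=
    aemeasurable_pi_lambda _ fun i => ht i
  have hLi : ∀ i : s, ∃ z : 𝕜, ∀ a : 𝕜,
      (L ∘SL ContinuousLinearMap.single ℝ (fun _ : s => 𝕜) i) a = RCLike.re (z * a) := by
    intro i
    -- every real-linear functional on `𝕜` is `a ↦ Re (z a)` for some `z`
    set l := L ∘SL ContinuousLinearMap.single ℝ (fun _ : s => 𝕜) i with hl
    refine ⟨(l 1 : 𝕜) - (l RCLike.I : 𝕜) * RCLike.I, fun a => ?_⟩
    rw [re_ofReal_sub_mul_I_mul]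
    conv_lhs => rw [← RCLike.re_add_im a]
    have e1 : ((RCLike.re a : ℝ) : 𝕜) = (RCLike.re a) • (1 : 𝕜) := by
      rw [RCLike.real_smul_eq_coe_mul, mul_one]
    have e2 : ((RCLike.im a : ℝ) : 𝕜) * RCLike.I = (RCLike.im a) • (RCLike.I : 𝕜) := by
      rw [RCLike.real_smul_eq_coe_mul]
    rw [e1, e2, map_add, map_smul, map_smul, smul_eq_mul, smul_eq_mul]
    ring
  choose z hz using hLi
  let z' : ι → 𝕜 := fun n => if hn : n ∈ s then z ⟨n, hn⟩ else 0
  have hz' : ∀ i : s, z' i = z i := fun i => by simp [z']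
  have hL : ∀ x : s → 𝕜, L x = RCLike.re (∑ i, z i * x i) := by
    intro x
    conv_lhs => rw [← Finset.univ_sum_single x]
    rw [map_sum, map_sum]
    exact Finset.sum_congr rfl fun i _ => hz i (x i)
  have hgauss : ∀ i : s, charFunDual (P.map (s.restrict t i))
      (L ∘SL ContinuousLinearMap.single ℝ (fun _ : s => 𝕜) i) =
      Complex.exp (-((reVar 𝕜 * ‖z i‖₊ ^ 2 : ℝ≥0) : ℝ) / 2) := by
    intro i
    rw [charFunDual_eq_charFun_map_one, AEMeasurable.map_map_of_aemeasurable
      (f := s.restrict t i) (by fun_prop) (ht i)]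
    have : ((L ∘SL ContinuousLinearMap.single ℝ (fun _ : s => 𝕜) i : 𝕜 →L[ℝ] ℝ) ∘ s.restrict t i)
        = fun ω => RCLike.re (∑ n ∈ {(i : ι)}, z' n * t n ω) := by
      ext ω
      rw [Function.comp_apply, hz, Finset.sum_singleton, hz']
      rfl
    rw [this, h, charFun_gaussianReal, Finset.sum_singleton, hz']
    congr 1
    push_cast
    ring
  rw [Finset.prod_congr rfl fun i _ => hgauss i, ← Complex.exp_sum,
    charFunDual_eq_charFun_map_one, AEMeasurable.map_map_of_aemeasurable (by fun_prop) hm]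
  have : (L ∘ fun ω (x : s) => s.restrict t x ω) =
      fun ω => RCLike.re (∑ n ∈ s, z' n * t n ω) := by
    ext ω
    rw [Function.comp_apply, hL, ← Finset.sum_coe_sort s]
    simp_rw [hz']
    rfl
  rw [this, h, charFun_gaussianReal, ← Finset.sum_coe_sort s]
  congr 1
  simp_rw [hz']
  push_cast
  rw [← Finset.sum_div, Finset.sum_neg_distrib]
  ring

/-- Centred Gaussian variables are stable under almost sure limits. -/
theorem isCenteredGaussian_of_tendsto_ae [IsProbabilityMeasure P] {g : ℕ → Ω → 𝕜} {g' : Ω → 𝕜}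
    {v : ℕ → ℝ≥0} {v' : ℝ≥0} (hg : ∀ k, IsCenteredGaussian P (g k) (v k))
    (h : ∀ᵐ ω ∂P, Tendsto (fun k => g k ω) atTop (𝓝 (g' ω))) (hv : Tendsto v atTop (𝓝 v')) :
    IsCenteredGaussian P g' v' := by
  have hm : AEMeasurable g' P := aemeasurable_of_tendsto_metrizable_ae atTop (fun k => (hg k).1) h
  refine ⟨hm, fun z => ?_⟩
  have hmz : AEMeasurable (fun ω => RCLike.re (z * g' ω)) P :=
    RCLike.measurable_re.comp_aemeasurable (hm.const_mul z)
  have : IsProbabilityMeasure (P.map fun ω => RCLike.re (z * g' ω)) :=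
    Measure.isProbabilityMeasure_map hmz
  refine Measure.ext_of_charFun (funext fun x => ?_)
  have hchar : ∀ {f : Ω → ℝ}, AEMeasurable f P →
      charFun (P.map f) x = ∫ ω, Complex.exp (x * f ω * Complex.I) ∂P := fun hf => by
    rw [charFun_apply_real, integral_map hf (by fun_prop)]
  have hlim : Tendsto (fun k => charFun (P.map fun ω => RCLike.re (z * g k ω)) x) atTop
      (𝓝 (charFun (P.map fun ω => RCLike.re (z * g' ω)) x)) := by
    rw [hchar hmz]
    simp_rw [fun k => hchar ((hg k).aemeasurable_re z)]
    refine tendsto_integral_of_dominated_convergence (fun _ => 1) (fun k => ?_)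
      (integrable_const _) (fun k => ae_of_all _ fun ω => ?_) ?_
    · have := (hg k).aemeasurable_re z
      exact (by fun_prop : AEMeasurable _ P).aestronglyMeasurable
    · rw [← Complex.ofReal_mul, Complex.norm_exp_ofReal_mul_I]
    · filter_upwards [h] with ω hω
      have h1 : Tendsto (fun k => RCLike.re (z * g k ω)) atTop (𝓝 (RCLike.re (z * g' ω))) :=
        (RCLike.continuous_re.tendsto _).comp (hω.const_mul z)
      have h2 : Continuous fun y : ℝ => Complex.exp (x * y * Complex.I) := by fun_prop
      exact (h2.tendsto _).comp h1
  refine tendsto_nhds_unique hlim ?_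
  simp_rw [fun k => (hg k).2 z, charFun_gaussianReal]
  have hv' : Tendsto (fun k => ((v k : ℝ) : ℂ)) atTop (𝓝 ((v' : ℝ) : ℂ)) :=
    (Complex.continuous_ofReal.tendsto _).comp ((NNReal.continuous_coe.tendsto _).comp hv)
  push_cast
  refine (Complex.continuous_exp.tendsto _).comp (tendsto_const_nhds.sub ?_)
  exact ((hv'.const_mul _).mul_const _).div_const _

/-- Gaussian lower tail: up to a constant factor, `P (|t|² > v)` is at least the density of `Re t`
at `√v + 1`. -/
theorem IsStdGaussian.le_measure_norm_sq [IsProbabilityMeasure P] {t : Ω → 𝕜}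
    (ht : IsStdGaussian P t) {η : ℝ} (hη : 0 < η) :
    ∃ c : ℝ, 0 < c ∧ ∀ v : ℝ, 0 ≤ v →
      ENNReal.ofReal (c * Real.exp (-((1 + η) * v / (2 * reVar 𝕜)))) ≤
        P {ω | v < ‖t ω‖ ^ 2} := by
  have hr : (0 : ℝ) < reVar 𝕜 := reVar_pos (𝕜 := 𝕜)
  refine ⟨(√(2 * Real.pi * reVar 𝕜))⁻¹ * Real.exp (-((1 + 1 / η) / (2 * reVar 𝕜))),
    by positivity, fun v hv => ?_⟩
  have h1 := ht.2 1
  simp only [one_mul, nnnorm_one, one_pow, mul_one] at h1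
  have hm : AEMeasurable (fun ω => RCLike.re (t ω)) P := RCLike.measurable_re.comp_aemeasurable ht.1
  calc _ ≤ gaussianReal 0 (reVar 𝕜) (Set.Ioc (√v) (√v + 1)) := ?_
    _ = P ((fun ω => RCLike.re (t ω)) ⁻¹' Set.Ioc (√v) (√v + 1)) := by
        rw [← h1, Measure.map_apply_of_aemeasurable hm measurableSet_Ioc]
    _ ≤ _ := by
        refine measure_mono fun ω hω => ?_
        have h2 : √v < RCLike.re (t ω) := hω.1
        have h3 : RCLike.re (t ω) ≤ ‖t ω‖ := RCLike.re_le_norm _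
        have h4 := Real.sqrt_nonneg v
        change v < ‖t ω‖ ^ 2
        nlinarith [Real.sq_sqrt hv]
  rw [gaussianReal_apply _ (reVar_pos (𝕜 := 𝕜)).ne']
  have hconst : ENNReal.ofReal ((√(2 * Real.pi * reVar 𝕜))⁻¹ *
      Real.exp (-((1 + 1 / η) / (2 * reVar 𝕜))) * Real.exp (-((1 + η) * v / (2 * reVar 𝕜)))) =
      ∫⁻ _ in Set.Ioc (√v) (√v + 1), ENNReal.ofReal ((√(2 * Real.pi * reVar 𝕜))⁻¹ *
      Real.exp (-((1 + 1 / η) / (2 * reVar 𝕜))) *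
        Real.exp (-((1 + η) * v / (2 * reVar 𝕜)))) := by
    simp
  rw [hconst]
  refine setLIntegral_mono (measurable_gaussianPDF _ _) fun y hy => ?_
  rw [gaussianPDF, gaussianPDFReal, mul_assoc, ← Real.exp_add]
  refine ENNReal.ofReal_le_ofReal (mul_le_mul_of_nonneg_left (Real.exp_le_exp.2 ?_) (by positivity))
  rw [← neg_add, ← add_div, neg_div, neg_le_neg_iff, sub_zero]
  gcongr
  have h4 := Real.sqrt_nonneg v
  have h5 : y ^ 2 ≤ (√v + 1) ^ 2 := by
    have := hy.1.le
    exact pow_le_pow_left₀ (h4.trans this) hy.2 2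
  -- `(√v + 1)² ≤ (1 + η) v + 1 + 1 / η`, since `2 √v ≤ η v + 1 / η`
  have h6 : 2 * √v ≤ η * v + 1 / η := by
    have h7 : 0 ≤ (η * √v - 1) ^ 2 / η := by positivity
    have h8 : (η * √v - 1) ^ 2 / η = η * (√v) ^ 2 - 2 * √v + 1 / η := by field_simp; ring
    rw [h8, Real.sq_sqrt hv] at h7
    linarith
  nlinarith [Real.sq_sqrt hv]

end Scalar

/-! ### The square root of the covariance and trace-class operators -/

section OperatorLemmas

variable {𝕜 : Type*} [RCLike 𝕜] {H : Type*} [NormedAddCommGroup H] [InnerProductSpace 𝕜 H]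

theorem countable_of_hilbertBasis [TopologicalSpace.SeparableSpace H] {ι : Type*}
    (b : HilbertBasis ι 𝕜 H) : Countable ι := by
  refine Pairwise.countable_of_isOpen_disjoint (s := fun n => Metric.ball (b n) (1 / 2)) ?_
    (fun _ => Metric.isOpen_ball) fun _ => Metric.nonempty_ball.2 (by norm_num)
  intro m n hmn
  refine Metric.ball_disjoint_ball ?_
  have h : ‖b m - b n‖ ^ 2 = 2 := by
    rw [@norm_sub_sq 𝕜, b.orthonormal.2 hmn, b.orthonormal.1, b.orthonormal.1]
    norm_num
  rw [dist_eq_norm]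
  nlinarith [norm_nonneg (b m - b n)]

theorem hilbertBasis_ext {ι : Type*} (b : HilbertBasis ι 𝕜 H) {x y : H}
    (h : ∀ n, ⟪b n, x⟫_𝕜 = ⟪b n, y⟫_𝕜) : x = y :=
  b.repr.injective (lp.ext (funext fun n => by rw [b.repr_apply_apply, b.repr_apply_apply, h]))

variable {κ : Type*} {C : H →L[𝕜] H} {b : HilbertBasis κ 𝕜 H} {μ : κ → ℝ}

theorem IsEigenbasis.adjoint [CompleteSpace H] (hC : IsEigenbasis C b μ) :
    IsEigenbasis (ContinuousLinearMap.adjoint C) b μ := by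
  classical
  intro n
  refine hilbertBasis_ext b fun m => ?_
  rw [ContinuousLinearMap.adjoint_inner_right, hC m, inner_smul_left, inner_smul_right,
    RCLike.conj_ofReal, orthonormal_iff_ite.1 b.orthonormal]
  split_ifs with h
  · rw [h]
  · simp

/-- A positive operator whose square has an eigenvector `x` with eigenvalue `a²` maps `x` to
`|a| x`. -/
theorem apply_eq_abs_smul {A : H →L[𝕜] H} (hA : A.IsPositive) {x : H} {a : ℝ}
    (h : A (A x) = ((a ^ 2 : ℝ) : 𝕜) • x) : A x = ((|a| : ℝ) : 𝕜) • x := by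
  rcases eq_or_ne a 0 with rfl | ha
  · have h1 : ⟪A x, A x⟫_𝕜 = 0 := by
      have := hA.1 (A x) x
      simp only [ContinuousLinearMap.coe_coe] at this
      rw [← this, h]
      simp
    simpa using inner_self_eq_zero.1 h1
  · -- `v = A x - |a| x` satisfies `A v = -|a| v`, so `v = 0` by positivity.
    set v := A x - ((|a| : ℝ) : 𝕜) • x with hv
    have hAv : A v = ((-|a| : ℝ) : 𝕜) • v := by
      rw [hv, map_sub, map_smul, h, smul_sub, smul_smul, ← RCLike.ofReal_mul,
        show -|a| * |a| = -(a ^ 2) by rw [neg_mul, abs_mul_abs_self]; ring]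
      push_cast
      module
    have hpos := hA.2 v
    rw [ContinuousLinearMap.reApplyInnerSelf, hAv, inner_smul_left, RCLike.conj_ofReal,
      RCLike.re_ofReal_mul, inner_self_eq_norm_sq] at hpos
    have : ‖v‖ = 0 := by
      by_contra hne
      have h1 : 0 < ‖v‖ ^ 2 := by positivity
      have h2 := abs_pos.2 ha
      nlinarith
    exact sub_eq_zero.1 (norm_eq_zero.1 this)

/-- The eigenvalues of a trace-class operator are absolutely summable: `|T|` has the eigenvalues
`|μ n|` on the same basis. -/
theorem IsTraceClass.summable_abs [CompleteSpace H] (hT : IsTraceClass C)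
    (hC : IsEigenbasis C b μ) : Summable fun n => |μ n| := by
  obtain ⟨A, hA, hA2, hs⟩ := hT
  have hAb : ∀ n, A (b n) = ((|μ n| : ℝ) : 𝕜) • b n := fun n => by
    refine apply_eq_abs_smul hA ?_
    have := congr($hA2 (b n))
    simp only [ContinuousLinearMap.comp_apply] at this
    rw [this, hC n, map_smul, hC.adjoint n, smul_smul, ← RCLike.ofReal_mul, sq]
  let b' : HilbertBasis (Set.range b) 𝕜 H :=
    HilbertBasis.mk b.orthonormal.toSubtypeRange (by
      rw [Subtype.range_coe, b.dense_span])
  have h1 := hs _ b'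
  have h2 := (Equiv.ofInjective b b.orthonormal.linearIndependent.injective).summable_iff.2 h1
  refine h2.congr fun n => ?_
  have hb' : b' (Equiv.ofInjective b b.orthonormal.linearIndependent.injective n) = b n := by
    simp [b']
  rw [Function.comp_apply, hb', hAb, inner_smul_right, inner_self_eq_norm_sq_to_K,
    b.orthonormal.1]
  simp

variable [CompleteSpace H]

theorem posSqrt_spec (hC : IsEigenbasis C b μ) (hμ : ∀ n, 0 < μ n) :
    (posSqrt C).IsPositive ∧ posSqrt C ∘L posSqrt C = C := by
  have h := exists_posSqrt hC fun n => (hμ n).le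
  rw [posSqrt, dif_pos h]
  exact h.choose_spec

theorem posSqrt_apply_posSqrt (hC : IsEigenbasis C b μ) (hμ : ∀ n, 0 < μ n)
    (x : H) : posSqrt C (posSqrt C x) = C x :=
  congr($((posSqrt_spec hC hμ).2) x)

theorem inner_posSqrt_left (hC : IsEigenbasis C b μ) (hμ : ∀ n, 0 < μ n)
    (x y : H) : ⟪posSqrt C x, y⟫_𝕜 = ⟪x, posSqrt C y⟫_𝕜 :=
  (posSqrt_spec hC hμ).1.1 x y

theorem norm_posSqrt_sq (hC : IsEigenbasis C b μ) (hμ : ∀ n, 0 < μ n)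
    (x : H) : ‖posSqrt C x‖ ^ 2 = RCLike.re ⟪x, C x⟫_𝕜 := by
  rw [← posSqrt_apply_posSqrt hC hμ, ← inner_posSqrt_left hC hμ, inner_self_eq_norm_sq]

theorem norm_posSqrt_basis_sq (hC : IsEigenbasis C b μ) (hμ : ∀ n, 0 < μ n)
    (m : κ) : ‖posSqrt C (b m)‖ ^ 2 = μ m := by
  rw [norm_posSqrt_sq hC hμ, hC m, inner_smul_right, inner_self_eq_norm_sq_to_K, b.orthonormal.1]
  simp

theorem posSqrt_injective (hC : IsEigenbasis C b μ) (hμ : ∀ n, 0 < μ n) :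
    Function.Injective (posSqrt C) := by
  refine (injective_iff_map_eq_zero _).2 fun x hx => hilbertBasis_ext b fun n => ?_
  have h1 : C x = 0 := by rw [← posSqrt_apply_posSqrt hC hμ, hx, map_zero]
  have h2 : ⟪ContinuousLinearMap.adjoint C (b n), x⟫_𝕜 = 0 := by
    rw [ContinuousLinearMap.adjoint_inner_left, h1, inner_zero_right]
  rw [hC.adjoint n, inner_smul_left, RCLike.conj_ofReal, mul_eq_zero] at h2
  rw [inner_zero_right]
  exact h2.resolve_left (by exact_mod_cast (hμ n).ne')

theorem denseRange_posSqrt (hC : IsEigenbasis C b μ) (hμ : ∀ n, 0 < μ n) :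
    DenseRange (posSqrt C) := by
  have h : Submodule.span 𝕜 (Set.range b) ≤ LinearMap.range (posSqrt C : H →ₗ[𝕜] H) := by
    rw [Submodule.span_le]
    rintro _ ⟨n, rfl⟩
    refine ⟨posSqrt C (((μ n : 𝕜)⁻¹) • b n), ?_⟩
    rw [ContinuousLinearMap.coe_coe, posSqrt_apply_posSqrt hC hμ, map_smul, hC n, smul_smul,
      inv_mul_cancel₀ (by exact_mod_cast (hμ n).ne'), one_smul]
  have hd : Dense (Submodule.span 𝕜 (Set.range b) : Set H) :=
    Submodule.dense_iff_topologicalClosure_eq_top.2 b.dense_span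
  exact hd.mono h

end OperatorLemmas

/-! ### The isonormal process and the Karhunen–Loève expansion -/

section Expansion

variable {𝕜 : Type*} [RCLike 𝕜] {H : Type*} [NormedAddCommGroup H] [InnerProductSpace 𝕜 H]
  {Ω : Type*} [MeasurableSpace Ω] {P : Measure Ω}

theorem eLpNorm_two_sq {E : Type*} [NormedAddCommGroup E] (g : Ω → E) :
    eLpNorm g 2 P ^ 2 = ∫⁻ ω, ENNReal.ofReal (‖g ω‖ ^ 2) ∂P := by
  have := eLpNorm_nnreal_pow_eq_lintegral (μ := P) (f := g) (p := 2) two_ne_zero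
  simp only [NNReal.coe_ofNat, ENNReal.rpow_ofNat] at this
  refine (Eq.trans ?_ this).trans (lintegral_congr fun ω => ?_)
  · norm_num
  · rw [ENNReal.ofReal_pow (norm_nonneg _), ofReal_norm]

theorem hasSum_norm_inner_sq {κ : Type*} (b : HilbertBasis κ 𝕜 H) (x : H) :
    HasSum (fun m => ‖⟪b m, x⟫_𝕜‖ ^ 2) (‖x‖ ^ 2) := by
  have h := RCLike.hasSum_re _ (b.hasSum_inner_mul_inner x x)
  rw [inner_self_eq_norm_sq] at h
  refine h.congr_fun fun m => ?_
  rw [← inner_conj_symm x (b m), RCLike.conj_mul, ← RCLike.ofReal_pow, RCLike.ofReal_re]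

theorem norm_sum_smul_sq {ι : Type*} {e : ι → H} (he : Orthonormal 𝕜 e) (z : ι → 𝕜)
    (s : Finset ι) : ‖∑ n ∈ s, z n • e n‖ ^ 2 = ∑ n ∈ s, ‖z n‖ ^ 2 := by
  rw [← inner_self_eq_norm_sq (𝕜 := 𝕜), he.inner_sum, map_sum]
  refine Finset.sum_congr rfl fun n _ => ?_
  rw [RCLike.conj_mul, ← RCLike.ofReal_pow, RCLike.ofReal_re]

theorem norm_sub_sum_sq_le {ι : Type*} {e : ι → H} (he : Orthonormal 𝕜 e) (x : H)
    (s : Finset ι) : ‖x - ∑ n ∈ s, ⟪e n, x⟫_𝕜 • e n‖ ^ 2 ≤ 4 * ‖x‖ ^ 2 := by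
  have h1 := norm_sum_smul_sq he (fun n => ⟪e n, x⟫_𝕜) s
  have h2 := he.sum_inner_products_le (x := x) (s := s)
  have h3 := norm_sub_le x (∑ n ∈ s, ⟪e n, x⟫_𝕜 • e n)
  have h4 : ‖∑ n ∈ s, ⟪e n, x⟫_𝕜 • e n‖ ≤ ‖x‖ :=
    le_of_sq_le_sq (h1.trans_le h2) (norm_nonneg _)
  calc _ ≤ (2 * ‖x‖) ^ 2 := pow_le_pow_left₀ (norm_nonneg _) (by linarith) 2
    _ = _ := by ring

variable [CompleteSpace H] {κ : Type*} {C : H →L[𝕜] H} {b : HilbertBasis κ 𝕜 H} {μ : κ → ℝ}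
  {φ : Ω → H}

theorem IsGaussianField.isCenteredGaussian_inner (hC : IsEigenbasis C b μ) (hμ : ∀ n, 0 < μ n)
    (hφ : IsGaussianField P C φ) (h : H) :
    IsCenteredGaussian P (fun ω => ⟪h, φ ω⟫_𝕜) (‖posSqrt C h‖₊ ^ 2) := by
  refine ⟨(hφ.1.const_inner (c := h)).aemeasurable, fun z => ?_⟩
  have h1 := hφ.2 ((starRingEnd 𝕜) z • h)
  simp_rw [inner_smul_left, RCLike.conj_conj] at h1
  rw [h1]
  congr 1
  rw [mul_assoc]
  congr 1
  ext
  have h2 := norm_posSqrt_sq hC hμ ((starRingEnd 𝕜) z • h)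
  rw [inner_smul_left, RCLike.conj_conj] at h2
  rw [← h2, Real.coe_toNNReal _ (sq_nonneg _), map_smul, norm_smul, RCLike.norm_conj, mul_pow]
  rfl

/-- The isonormal process of a Gaussian field `φ` with covariance `C`: a conjugate-linear family
`w x`, `x ∈ H`, of centred Gaussian variables of variance `‖x‖²` with `w (C^{1/2} h) = ⟪h, φ⟫`. It
is the continuous extension of `C^{1/2} h ↦ ⟪h, φ⟫` from the dense range of `C^{1/2}`. -/
theorem IsGaussianField.exists_isonormal [IsProbabilityMeasure P] (hC : IsEigenbasis C b μ)
    (hμ : ∀ n, 0 < μ n) (hφ : IsGaussianField P C φ) :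
    ∃ w : H →ₗ⋆[𝕜] Lp 𝕜 2 P,
      (∀ h, w (posSqrt C h) =ᵐ[P] fun ω => ⟪h, φ ω⟫_𝕜) ∧
      ∀ x, IsCenteredGaussian P (w x) (‖x‖₊ ^ 2) := by
  have hG := fun h => hφ.isCenteredGaussian_inner hC hμ h
  have hbound : ∀ h, eLpNorm (fun ω => ⟪h, φ ω⟫_𝕜) 2 P ≤
      ENNReal.ofReal (√2 * ‖posSqrt C h‖) := by
    intro h
    have h1 := (hG h).lintegral_norm_sq_le
    rw [← eLpNorm_two_sq] at h1
    refine (ENNReal.pow_le_pow_left_iff two_ne_zero).1 (h1.trans_eq ?_)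
    rw [← ENNReal.ofReal_pow (by positivity), mul_pow, Real.sq_sqrt zero_le_two,
      ENNReal.ofReal_mul zero_le_two, ENNReal.ofReal_pow (norm_nonneg _), ofReal_norm]
    simp
    rfl
  have hmem : ∀ h, MemLp (fun ω => ⟪h, φ ω⟫_𝕜) 2 P := fun h =>
    ⟨hφ.1.const_inner, (hbound h).trans_lt ENNReal.ofReal_lt_top⟩
  let Y : H →ₗ⋆[𝕜] Lp 𝕜 2 P :=
    { toFun := fun h => (hmem h).toLp
      map_add' := fun x y => by
        rw [← MemLp.toLp_add]
        exact MemLp.toLp_congr _ _ (ae_of_all _ fun ω => inner_add_left _ _ _)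
      map_smul' := fun z x => by
        rw [← MemLp.toLp_const_smul]
        exact MemLp.toLp_congr _ _ (ae_of_all _ fun ω => inner_smul_left _ _ _) }
  let R : H →ₗ[𝕜] H := posSqrt C
  have hYn : ∀ h, ‖Y h‖ ≤ √2 * ‖R h‖ := fun h => by
    change ‖(hmem h).toLp‖ ≤ _
    rw [Lp.norm_toLp]
    exact ENNReal.toReal_le_of_le_ofReal (by positivity) (hbound h)
  have hd : DenseRange R := denseRange_posSqrt hC hμ
  set W := Y.extendOfNorm R
  have hWR : ∀ h, W (R h) = Y h := LinearMap.extendOfNorm_eq hd ⟨_, hYn⟩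
  have hWR' : ∀ h, W (posSqrt C h) =ᵐ[P] fun ω => ⟪h, φ ω⟫_𝕜 := fun h => by
    have : W (posSqrt C h) = (hmem h).toLp := hWR h
    rw [this]
    exact MemLp.coeFn_toLp _
  refine ⟨W, hWR', fun x => ?_⟩
  obtain ⟨y, hyR, hy⟩ := mem_closure_iff_seq_limit.1 (hd x)
  choose y' hy' using hyR
  have hlim : Tendsto (fun k => W (y k)) atTop (𝓝 (W x)) := (W.continuous.tendsto x).comp hy
  obtain ⟨ns, hns, hae⟩ := (tendstoInMeasure_of_tendsto_Lp hlim).exists_seq_tendsto_ae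
  refine isCenteredGaussian_of_tendsto_ae (g := fun k => W (y (ns k)))
    (v := fun k => ‖y (ns k)‖₊ ^ 2) (fun k => ?_) hae ?_
  · have := (hG (y' (ns k))).congr (hWR' _).symm
    have h2 : posSqrt C (y' (ns k)) = y (ns k) := hy' (ns k)
    rwa [h2] at this
  · exact ((hy.comp hns.tendsto_atTop).nnnorm).pow 2

/-- Existence of the generalized Karhunen–Loève expansion in an arbitrary orthonormal basis: the
coefficients are the values of the isonormal process on the basis. -/
theorem IsGaussianField.exists_isKarhunenLoeve [IsProbabilityMeasure P] [Countable κ]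
    (hC : IsEigenbasis C b μ) (hμ : ∀ n, 0 < μ n) (hsum : Summable μ)
    (hφ : IsGaussianField P C φ) {ι : Type*} (e : HilbertBasis ι 𝕜 H) :
    ∃ t : ι → Ω → 𝕜, IsKarhunenLoeve P C φ e t := by
  obtain ⟨w, hwR, hw⟩ := hφ.exists_isonormal hC hμ
  have hsumw : ∀ (s : Finset ι) (z : ι → 𝕜),
      w (∑ n ∈ s, (starRingEnd 𝕜) (z n) • e n) =ᵐ[P] fun ω => ∑ n ∈ s, z n * w (e n) ω := by
    intro s z
    rw [map_sum]
    simp_rw [LinearMap.map_smulₛₗ, RCLike.conj_conj]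
    filter_upwards [Lp.coeFn_fun_finsetSum s fun n => z n • w (e n),
      (Finset.eventually_all s).2 fun n _ => Lp.coeFn_smul (z n) (w (e n))] with ω h1 h2
    rw [h1]
    refine Finset.sum_congr rfl fun n hn => ?_
    rw [h2 n hn]
    rfl
  refine ⟨fun n => w (e n), fun n => ?_, ?_, ?_⟩
  · rw [isStdGaussian_iff]
    have := hw (e n)
    rwa [show ‖e n‖₊ = 1 from NNReal.eq (e.orthonormal.1 n), one_pow] at this
  · refine iIndepFun_of_isCenteredGaussian_sum (fun n => (hw (e n)).1) fun s z => ?_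
    have h1 := ((hw _).congr (hsumw s z)).2 1
    simp only [one_mul, nnnorm_one, one_pow, mul_one] at h1
    rw [h1, ← Finset.mul_sum]
    congr 2
    ext
    push_cast
    rw [norm_sum_smul_sq e.orthonormal]
    simp
  · have hres : ∀ (s : Finset ι) (m : κ), ∫⁻ ω, ENNReal.ofReal
        (‖⟪b m, φ ω - ∑ n ∈ s, w (e n) ω • posSqrt C (e n)⟫_𝕜‖ ^ 2) ∂P ≤
        2 * ENNReal.ofReal (‖posSqrt C (b m) -
          ∑ n ∈ s, ⟪e n, posSqrt C (b m)⟫_𝕜 • e n‖ ^ 2) := by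
      intro s m
      set x := posSqrt C (b m) with hx
      have h1 := (hw (x - ∑ n ∈ s, ⟪e n, x⟫_𝕜 • e n)).lintegral_norm_sq_le
      have h2 := hsumw s fun n => ⟪x, e n⟫_𝕜
      simp_rw [inner_conj_symm] at h2
      have h3 := Lp.coeFn_sub (w x) (w (∑ n ∈ s, ⟪e n, x⟫_𝕜 • e n))
      rw [← map_sub] at h3
      refine le_of_eq_of_le (lintegral_congr_ae ?_) (h1.trans_eq ?_)
      · filter_upwards [h2, h3, hwR (b m)] with ω h2 h3 h4
        rw [h3, Pi.sub_apply, h2, h4, inner_sub_right, inner_sum]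
        congr 4
        refine Finset.sum_congr rfl fun n _ => ?_
        rw [inner_smul_right, mul_comm, ← inner_posSqrt_left hC hμ]
      · congr 1
        rw [ENNReal.ofReal_pow (norm_nonneg _), ofReal_norm]
        rfl
    have hm : ∀ s : Finset ι, AEStronglyMeasurable
        (fun ω => φ ω - ∑ n ∈ s, w (e n) ω • posSqrt C (e n)) P := fun s =>
      hφ.1.sub (Finset.aestronglyMeasurable_fun_sum _ fun n _ =>
        (Lp.aestronglyMeasurable _).smul_const _)
    have hle : ∀ s : Finset ι,
        eLpNorm (fun ω => φ ω - ∑ n ∈ s, w (e n) ω • posSqrt C (e n)) 2 P ^ 2 ≤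
        2 * ENNReal.ofReal (∑' m, ‖posSqrt C (b m) -
          ∑ n ∈ s, ⟪e n, posSqrt C (b m)⟫_𝕜 • e n‖ ^ 2) := by
      intro s
      have hsm : Summable fun m => ‖posSqrt C (b m) -
          ∑ n ∈ s, ⟪e n, posSqrt C (b m)⟫_𝕜 • e n‖ ^ 2 :=
        (hsum.mul_left 4).of_nonneg_of_le (fun m => sq_nonneg _) fun m => by
          rw [← norm_posSqrt_basis_sq hC hμ]
          exact norm_sub_sum_sq_le e.orthonormal _ s
      rw [eLpNorm_two_sq, ENNReal.ofReal_tsum_of_nonneg (fun m => sq_nonneg _) hsm,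
        ← ENNReal.tsum_mul_left]
      refine le_of_eq_of_le ?_ (ENNReal.tsum_le_tsum fun m => hres s m)
      rw [← lintegral_tsum fun m =>
        ((hm s).const_inner.norm.aemeasurable.pow_const 2).ennreal_ofReal]
      refine lintegral_congr fun ω => ?_
      have := hasSum_norm_inner_sq b (φ ω - ∑ n ∈ s, w (e n) ω • posSqrt C (e n))
      rw [← this.tsum_eq, ENNReal.ofReal_tsum_of_nonneg (fun m => sq_nonneg _) this.summable]
    have hzero : Tendsto (fun s : Finset ι => ∑' m, ‖posSqrt C (b m) -
        ∑ n ∈ s, ⟪e n, posSqrt C (b m)⟫_𝕜 • e n‖ ^ 2) atTop (𝓝 0) := by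
      have := tendsto_tsum_of_dominated_convergence (𝓕 := (atTop : Filter (Finset ι)))
        (f := fun s m => ‖posSqrt C (b m) - ∑ n ∈ s, ⟪e n, posSqrt C (b m)⟫_𝕜 • e n‖ ^ 2)
        (g := fun _ => (0 : ℝ)) (bound := fun m => 4 * μ m) (hsum.mul_left 4) (fun m => ?_)
        (Eventually.of_forall fun s m => ?_)
      · simpa using this
      · have h1 := e.hasSum_repr (posSqrt C (b m))
        simp_rw [e.repr_apply_apply] at h1
        have h2 := ((tendsto_const_nhds (x := posSqrt C (b m))).sub h1).norm.pow 2
        simpa using h2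
      · rw [Real.norm_of_nonneg (sq_nonneg _), ← norm_posSqrt_basis_sq hC hμ]
        exact norm_sub_sum_sq_le e.orthonormal _ s
    have h0 : Tendsto (fun s : Finset ι =>
        eLpNorm (fun ω => φ ω - ∑ n ∈ s, w (e n) ω • posSqrt C (e n)) 2 P ^ 2) atTop (𝓝 0) := by
      refine tendsto_of_tendsto_of_tendsto_of_le_of_le tendsto_const_nhds ?_
        (fun s => zero_le) hle
      have := ENNReal.Tendsto.const_mul (a := 2) (ENNReal.tendsto_ofReal hzero)
        (Or.inr ENNReal.ofNat_ne_top)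
      simpa using this
    have h1 := (ENNReal.continuous_rpow_const (y := (2⁻¹ : ℝ))).tendsto 0 |>.comp h0
    rw [ENNReal.zero_rpow_of_pos (by norm_num)] at h1
    refine h1.congr fun s => ?_
    rw [Function.comp_apply, ← ENNReal.rpow_ofNat, ← ENNReal.rpow_mul]
    norm_num

end Expansion

/-! ### The random quadratic form -/

section QuadraticForm

variable {𝕜 : Type*} [RCLike 𝕜] {H : Type*} [NormedAddCommGroup H] [InnerProductSpace 𝕜 H]
  {Ω ι : Type*} {C M : H →L[𝕜] H} {Φ : Submodule 𝕜 H} {hΦ : ∀ x, posSqrt C x ∈ Φ}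
  {O : Φ →ₗ[𝕜] (Φ →ₗ⋆[𝕜] 𝕜)} {e : HilbertBasis ι 𝕜 H} {lam : ι → ℝ} {t : ι → Ω → 𝕜}

theorem coe_sum_smul_posSqrt (z : ι → 𝕜) (s : Finset ι) :
    ((∑ n ∈ s, z n • (⟨posSqrt C (e n), hΦ (e n)⟩ : Φ) : Φ) : H) =
      ∑ n ∈ s, z n • posSqrt C (e n) := by
  rw [AddSubmonoidClass.coe_finsetSum]
  exact Finset.sum_congr rfl fun n _ => Submodule.coe_smul _ _

theorem partialForm_eq (hM : IsSandwich C hΦ O M) (he : IsEigenbasis M e lam) (s : Finset ι)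
    (ω : Ω) : partialForm C hΦ O e t s ω = ∑ n ∈ s, lam n * ‖t n ω‖ ^ 2 := by
  have h : (∑ n ∈ s, t n ω • (⟨posSqrt C (e n), hΦ (e n)⟩ : Φ) : Φ) =
      ⟨posSqrt C (∑ n ∈ s, t n ω • e n), hΦ _⟩ := Subtype.ext <| by
    rw [coe_sum_smul_posSqrt (hΦ := hΦ) (e := e) (fun n => t n ω) s]
    simp only [map_sum, map_smul]
  rw [partialForm, h, ← hM, map_sum]
  simp_rw [map_smul, he _, smul_smul]
  rw [e.orthonormal.inner_sum, map_sum]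
  refine Finset.sum_congr rfl fun n _ => ?_
  rw [← mul_assoc, RCLike.conj_mul, ← RCLike.ofReal_pow, ← RCLike.ofReal_mul, RCLike.ofReal_re,
    mul_comm]

variable [MeasurableSpace Ω] {P : Measure Ω}

theorem lintegral_tsum_lt_top [Countable ι] (ht : ∀ n, IsStdGaussian P (t n))
    (hl : Summable fun n => |lam n|) :
    ∫⁻ ω, ∑' n, ENNReal.ofReal (|lam n| * ‖t n ω‖ ^ 2) ∂P < ∞ := by
  rw [lintegral_tsum fun n => (((ht n).1.norm.pow_const 2).const_mul _).ennreal_ofReal]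
  have h : ∀ n, ∫⁻ ω, ENNReal.ofReal (|lam n| * ‖t n ω‖ ^ 2) ∂P ≤
      ENNReal.ofReal (|lam n|) * 2 := fun n => by
    simp_rw [ENNReal.ofReal_mul (abs_nonneg (lam n))]
    rw [lintegral_const_mul' _ _ ENNReal.ofReal_ne_top]
    gcongr
    simpa using (isStdGaussian_iff.1 (ht n)).lintegral_norm_sq_le
  refine (ENNReal.tsum_le_tsum h).trans_lt ?_
  rw [ENNReal.tsum_mul_right, ← ENNReal.ofReal_tsum_of_nonneg (fun n => abs_nonneg _) hl]
  exact ENNReal.mul_lt_top ENNReal.ofReal_lt_top ENNReal.ofNat_lt_top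

theorem ae_summable [Countable ι] (ht : ∀ n, IsStdGaussian P (t n))
    (hl : Summable fun n => |lam n|) : ∀ᵐ ω ∂P, Summable fun n => lam n * ‖t n ω‖ ^ 2 := by
  have hm : AEMeasurable (fun ω => ∑' n, ENNReal.ofReal (|lam n| * ‖t n ω‖ ^ 2)) P :=
    AEMeasurable.tsum fun n =>
      (((ht n).1.norm.pow_const 2).const_mul _).ennreal_ofReal
  filter_upwards [ae_lt_top' hm (lintegral_tsum_lt_top ht hl).ne] with ω hω
  refine Summable.of_norm ?_
  have := ENNReal.summable_toReal hω.ne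
  refine this.congr fun n => ?_
  rw [ENNReal.toReal_ofReal (by positivity), norm_mul, Real.norm_eq_abs, norm_pow, norm_norm]

/-- Almost surely the limit defining `⟨φ|O|φ⟩` exists, and it is `∑ n, lam n |t n|²`. -/
theorem ae_hasSum_quadForm [Countable ι] (hM : IsSandwich C hΦ O M) (he : IsEigenbasis M e lam)
    (ht : ∀ n, IsStdGaussian P (t n)) (hl : Summable fun n => |lam n|) :
    ∀ᵐ ω ∂P, HasSum (fun n => lam n * ‖t n ω‖ ^ 2) (quadForm C hΦ O e t ω) := by
  filter_upwards [ae_summable ht hl] with ω hω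
  have h : Tendsto (fun s : Finset ι => partialForm C hΦ O e t s ω) atTop
      (𝓝 (∑' n, lam n * ‖t n ω‖ ^ 2)) := by
    simp_rw [partialForm_eq hM he]
    exact hω.hasSum
  rw [quadForm, h.limUnder_eq]
  exact hω.hasSum

/-- The partial sums of the expansion converge to `φ` almost surely along some sequence of finite
index sets. -/
theorem IsKarhunenLoeve.exists_seq_tendsto_ae [Countable ι] {φ : Ω → H}
    (hφ : AEStronglyMeasurable φ P) (ht : IsKarhunenLoeve P C φ e t) :
    ∃ s : ℕ → Finset ι, Tendsto s atTop atTop ∧ ∀ᵐ ω ∂P,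
      Tendsto (fun k => ∑ n ∈ s k, t n ω • posSqrt C (e n)) atTop (𝓝 (φ ω)) := by
  have hm : ∀ s : Finset ι,
      AEStronglyMeasurable (fun ω => ∑ n ∈ s, t n ω • posSqrt C (e n)) P := fun s =>
    Finset.aestronglyMeasurable_fun_sum _ fun n _ =>
      (ht.1 n).1.aestronglyMeasurable.smul_const _
  refine (tendstoInMeasure_of_tendsto_eLpNorm two_ne_zero hm hφ ?_).exists_seq_tendsto_ae'
  refine ht.2.2.congr fun s => ?_
  rw [eLpNorm_sub_comm]
  rfl

theorem quadForm_eq_of_bounded [Countable ι] {φ : Ω → H} (hφ : AEStronglyMeasurable φ P)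
    (ht : IsKarhunenLoeve P C φ e t) (hM : IsSandwich C hΦ O M) (he : IsEigenbasis M e lam)
    (hl : Summable fun n => |lam n|) (B : H →L[𝕜] H)
    (hB : ∀ f g : Φ, O f g = inner 𝕜 (g : H) (B f)) :
    ∀ᵐ ω ∂P, quadForm C hΦ O e t ω = RCLike.re (inner 𝕜 (φ ω) (B (φ ω))) := by
  obtain ⟨s, hs, hae⟩ := ht.exists_seq_tendsto_ae hφ
  filter_upwards [hae, ae_hasSum_quadForm hM he ht.1 hl] with ω h1 h2
  have h3 := h2.comp hs
  refine tendsto_nhds_unique h3 ?_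
  have h4 : Continuous fun x : H => RCLike.re (inner 𝕜 x (B x)) := by fun_prop
  refine ((h4.tendsto _).comp h1).congr fun k => ?_
  rw [Function.comp_apply, Function.comp_apply, ← partialForm_eq hM he, partialForm, hB,
    coe_sum_smul_posSqrt (hΦ := hΦ) (e := e) (fun n => t n ω) (s k)]

end QuadraticForm

/-! ### Exponential moments -/

section ExponentialMoments

/-- Jensen's inequality for the exponential function and countably many weights, without any
summability assumption on the right-hand side. -/
theorem ofReal_exp_le_tsum {κ : Type*} {w y : κ → ℝ} {Y : ℝ} (hw : ∀ m, 0 ≤ w m)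
    (hw1 : HasSum w 1) (hY : HasSum (fun m => w m * y m) Y) :
    ENNReal.ofReal (Real.exp Y) ≤ ∑' m, ENNReal.ofReal (w m * Real.exp (y m)) := by
  by_cases hs : Summable fun m => w m * Real.exp (y m)
  · rw [← ENNReal.ofReal_tsum_of_nonneg (fun m => mul_nonneg (hw m) (Real.exp_pos _).le) hs]
    refine ENNReal.ofReal_le_ofReal ?_
    -- the tangent line of `exp` at `Y`
    have h1 : HasSum (fun m => Real.exp Y * (w m * y m + (1 - Y) * w m)) (Real.exp Y) := by
      have := (hY.add (hw1.mul_left (1 - Y))).mul_left (Real.exp Y)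
      rwa [show Real.exp Y * (Y + (1 - Y) * 1) = Real.exp Y by ring] at this
    refine hasSum_le (fun m => ?_) h1 hs.hasSum
    have h2 : Real.exp (y m) = Real.exp Y * Real.exp (y m - Y) := by
      rw [← Real.exp_add]; ring_nf
    have h3 := Real.add_one_le_exp (y m - Y)
    have h4 : Real.exp Y * (y m - Y + 1) ≤ Real.exp (y m) := by
      rw [h2]; gcongr
    calc _ = w m * (Real.exp Y * (y m - Y + 1)) := by ring
      _ ≤ _ := mul_le_mul_of_nonneg_left h4 (hw m)
  · have : ∑' m, ENNReal.ofReal (w m * Real.exp (y m)) = ∞ := by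
      by_contra hne
      refine hs ((ENNReal.summable_toReal hne).congr fun m => ?_)
      rw [ENNReal.toReal_ofReal (mul_nonneg (hw m) (Real.exp_pos _).le)]
    rw [this]
    exact le_top

variable {𝕜 : Type*} [RCLike 𝕜] {Ω : Type*} [MeasurableSpace Ω] {P : Measure Ω}
  [IsProbabilityMeasure P] {ι : Type*} {t : ι → Ω → 𝕜}

/-- For `a ≤ x₀` the exponential moment of `a |t|²` is bounded linearly in the exponent, uniformly
down to `a = 0`: `exp` lies below its chord over `[0, x₀ |t|²]`. -/
theorem IsStdGaussian.lintegral_exp_mul_sq_le {t : Ω → 𝕜} (ht : IsStdGaussian P t) {x₀ : ℝ}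
    (hx₀ : 0 < x₀) (hlt : 2 * reVar 𝕜 * x₀ < 1) {a : ℝ} (ha : a ≤ x₀) :
    ∫⁻ ω, ENNReal.ofReal (Real.exp (a * ‖t ω‖ ^ 2)) ∂P ≤
      ENNReal.ofReal (Real.exp (|a| * ((expSqMoment (reVar 𝕜) x₀ ^ 2).toReal / x₀))) := by
  set K := (expSqMoment (reVar 𝕜) x₀ ^ 2).toReal
  have hK0 : 0 ≤ K := ENNReal.toReal_nonneg
  rcases le_total a 0 with h0 | h0
  · calc _ ≤ ∫⁻ _, 1 ∂P := lintegral_mono fun ω => by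
          rw [← ENNReal.ofReal_one]
          refine ENNReal.ofReal_le_ofReal (Real.exp_le_one_iff.2 ?_)
          exact mul_nonpos_of_nonpos_of_nonneg h0 (sq_nonneg _)
      _ = ENNReal.ofReal 1 := by simp
      _ ≤ _ := ENNReal.ofReal_le_ofReal (Real.one_le_exp (by positivity))
  · have hint := (isStdGaussian_iff.1 ht).lintegral_exp_sq_le (x₀ := x₀) hx₀.le (by simp)
    have htop : expSqMoment (reVar 𝕜) x₀ ^ 2 ≠ ∞ :=
      ENNReal.pow_ne_top (expSqMoment_lt_top reVar_pos hlt).ne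
    have hl1 : a / x₀ ≤ 1 := (div_le_one hx₀).2 ha
    have hpt : ∀ ω, ENNReal.ofReal (Real.exp (a * ‖t ω‖ ^ 2)) ≤
        1 + ENNReal.ofReal (a / x₀) * ENNReal.ofReal (Real.exp (x₀ * ‖t ω‖ ^ 2)) := fun ω => by
      rw [← ENNReal.ofReal_one, ← ENNReal.ofReal_mul (by positivity),
        ← ENNReal.ofReal_add zero_le_one (by positivity)]
      refine ENNReal.ofReal_le_ofReal ?_
      have h := convexOn_exp.2 (Set.mem_univ 0) (Set.mem_univ (x₀ * ‖t ω‖ ^ 2))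
        (sub_nonneg.2 hl1) (by positivity : 0 ≤ a / x₀) (by ring)
      simp only [smul_eq_mul, mul_zero, zero_add, Real.exp_zero, mul_one] at h
      have h1 : a / x₀ * (x₀ * ‖t ω‖ ^ 2) = a * ‖t ω‖ ^ 2 := by field_simp
      rw [h1] at h
      have : 0 ≤ a / x₀ := by positivity
      linarith
    calc _ ≤ ∫⁻ ω, (1 + ENNReal.ofReal (a / x₀) *
            ENNReal.ofReal (Real.exp (x₀ * ‖t ω‖ ^ 2))) ∂P := lintegral_mono hpt
      _ ≤ 1 + ENNReal.ofReal (a / x₀) * ENNReal.ofReal K := by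
          rw [lintegral_add_left measurable_const, lintegral_const_mul' _ _ ENNReal.ofReal_ne_top,
            ENNReal.ofReal_toReal htop]
          simp only [lintegral_const, measure_univ, mul_one]
          gcongr
      _ = ENNReal.ofReal (a / x₀ * K + 1) := by
          rw [← ENNReal.ofReal_mul (by positivity), ENNReal.ofReal_add (by positivity) zero_le_one,
            ENNReal.ofReal_one, add_comm]
      _ ≤ _ := by
          refine ENNReal.ofReal_le_ofReal ((Real.add_one_le_exp _).trans_eq ?_)
          rw [abs_of_nonneg h0]
          ring_nf

theorem lintegral_exp_sum_le (ht : ∀ n, IsStdGaussian P (t n)) (hi : iIndepFun t P)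
    (htm : ∀ n, Measurable (t n)) {x₀ : ℝ} (hx₀ : 0 < x₀) (hlt : 2 * reVar 𝕜 * x₀ < 1)
    {a : ι → ℝ} {s : Finset ι} (ha : ∀ n ∈ s, a n ≤ x₀) :
    ∫⁻ ω, ENNReal.ofReal (Real.exp (∑ n ∈ s, a n * ‖t n ω‖ ^ 2)) ∂P ≤
      ENNReal.ofReal (Real.exp ((∑ n ∈ s, |a n|) *
        ((expSqMoment (reVar 𝕜) x₀ ^ 2).toReal / x₀))) := by
  have hind : iIndepFun (fun n ω => ENNReal.ofReal (Real.exp (a n * ‖t n ω‖ ^ 2))) P :=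
    hi.comp (fun n z => ENNReal.ofReal (Real.exp (a n * ‖z‖ ^ 2))) fun n => by fun_prop
  simp_rw [Real.exp_sum, ENNReal.ofReal_prod_of_nonneg fun _ _ => (Real.exp_pos _).le]
  rw [lintegral_prod_eq_prod_lintegral_of_indepFun s _ hind fun n => by
    have := htm n
    fun_prop]
  rw [Finset.sum_mul, Real.exp_sum, ENNReal.ofReal_prod_of_nonneg fun _ _ => (Real.exp_pos _).le]
  exact Finset.prod_le_prod' fun n hn => (ht n).lintegral_exp_mul_sq_le hx₀ hlt (ha n hn)

variable {H : Type*} [NormedAddCommGroup H] [InnerProductSpace 𝕜 H] [CompleteSpace H]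
  {κ : Type*} {C : H →L[𝕜] H} {b : HilbertBasis κ 𝕜 H} {μ : κ → ℝ} {e : HilbertBasis ι 𝕜 H}

/-- A Fernique-type bound, uniform over the partial sums of the expansion of the field. With the
weights `μ m / ∑ μ`, Jensen's inequality reduces it to the exponential moments of the squared
components in the eigenbasis of `C`, the `m`-th of which has variance at most `μ m`. -/
theorem lintegral_exp_norm_sq_le [Countable κ] (hC : IsEigenbasis C b μ) (hμ : ∀ n, 0 < μ n)
    {τ : ℝ} (hτ : HasSum μ τ) (hτ0 : 0 < τ) (ht : ∀ n, IsStdGaussian P (t n))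
    (hi : iIndepFun t P) {γ x₀ : ℝ} (hγ : 0 ≤ γ) (hγx : γ * τ ≤ x₀) (s : Finset ι) :
    ∫⁻ ω, ENNReal.ofReal (Real.exp (γ * ‖∑ n ∈ s, t n ω • posSqrt C (e n)‖ ^ 2)) ∂P ≤
      expSqMoment (reVar 𝕜) x₀ ^ 2 := by
  set K := expSqMoment (reVar 𝕜) x₀ ^ 2
  have hw1 : HasSum (fun m => μ m / τ) 1 := by
    simpa [div_self hτ0.ne'] using hτ.div_const τ
  have hcoef : ∀ m ω, ⟪b m, ∑ n ∈ s, t n ω • posSqrt C (e n)⟫_𝕜 =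
      ∑ n ∈ s, ⟪b m, posSqrt C (e n)⟫_𝕜 * t n ω := fun m ω => by
    rw [inner_sum]
    exact Finset.sum_congr rfl fun n _ => by rw [inner_smul_right, mul_comm]
  have hg : ∀ m, IsCenteredGaussian P
      (fun ω => ⟪b m, ∑ n ∈ s, t n ω • posSqrt C (e n)⟫_𝕜)
      (∑ n ∈ s, ‖⟪b m, posSqrt C (e n)⟫_𝕜‖₊ ^ 2) := fun m => by
    simp_rw [hcoef m]
    exact isCenteredGaussian_sum ht hi _ s
  have hvar : ∀ m, ((∑ n ∈ s, ‖⟪b m, posSqrt C (e n)⟫_𝕜‖₊ ^ 2 : ℝ≥0) : ℝ) ≤ μ m := fun m => by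
    push_cast
    rw [← norm_posSqrt_basis_sq hC hμ]
    refine le_of_eq_of_le (Finset.sum_congr rfl fun n _ => ?_)
      (e.orthonormal.sum_inner_products_le (x := posSqrt C (b m)) (s := s))
    rw [← inner_posSqrt_left hC hμ, norm_inner_symm]
  calc _ ≤ ∫⁻ ω, ∑' m, ENNReal.ofReal (μ m / τ * Real.exp (γ * τ / μ m *
          ‖⟪b m, ∑ n ∈ s, t n ω • posSqrt C (e n)⟫_𝕜‖ ^ 2)) ∂P := by
        refine lintegral_mono fun ω => ofReal_exp_le_tsum
          (fun m => div_nonneg (hμ m).le hτ0.le) hw1 ?_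
        refine ((hasSum_norm_inner_sq b _).mul_left γ).congr_fun fun m => ?_
        have := (hμ m).ne'
        field_simp
    _ = ∑' m, ∫⁻ ω, ENNReal.ofReal (μ m / τ * Real.exp (γ * τ / μ m *
          ‖⟪b m, ∑ n ∈ s, t n ω • posSqrt C (e n)⟫_𝕜‖ ^ 2)) ∂P := by
        refine lintegral_tsum fun m => ?_
        have := (hg m).1
        fun_prop
    _ ≤ ∑' m, ENNReal.ofReal (μ m / τ) * K := by
        refine ENNReal.tsum_le_tsum fun m => ?_
        simp_rw [ENNReal.ofReal_mul (div_nonneg (hμ m).le hτ0.le)]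
        rw [lintegral_const_mul' _ _ ENNReal.ofReal_ne_top]
        gcongr
        have h0 : 0 ≤ γ * τ / μ m := div_nonneg (by positivity) (hμ m).le
        refine (hg m).lintegral_exp_sq_le h0 ?_
        calc _ ≤ γ * τ / μ m * μ m := mul_le_mul_of_nonneg_left (hvar m) h0
          _ = γ * τ := div_mul_cancel₀ _ (hμ m).ne'
          _ ≤ x₀ := hγx
    _ = K := by
        rw [ENNReal.tsum_mul_right, ← ENNReal.ofReal_tsum_of_nonneg
          (fun m => div_nonneg (hμ m).le hτ0.le) hw1.summable, hw1.tsum_eq, ENNReal.ofReal_one,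
          one_mul]

end ExponentialMoments

/-! ### The exponential Chebyshev bound -/

section UpperBound

/-- The parameters of the exponential Chebyshev inequality. The decay rate `θ` exceeds the rate
`r / A` of the tail of the quadratic form; `p` and `q` are conjugate exponents with `p A' < A`, and
`ϰ` is the weight given to the residual energy. -/
theorem exists_chernoff_parameters {r A A' δ τ : ℝ} (hr : 0 < r) (hA' : 0 ≤ A') (hAA' : A' < A)
    (hδ : 0 < δ) (hτ : 0 < τ) :
    ∃ p q ϰ θ x₀ : ℝ, 0 < p ∧ 0 < q ∧ 1 / p + 1 / q = 1 ∧ 0 < ϰ ∧ r / A < θ ∧ 0 < x₀ ∧ x₀ < r ∧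
      θ * (A - ϰ * δ) ≤ x₀ ∧ p * θ * A' ≤ x₀ ∧ q * θ * ϰ * τ ≤ x₀ := by
  have hA : 0 < A := hA'.trans_lt hAA'
  have hd : 0 < A - A' := sub_pos.2 hAA'
  set p := 2 * A / (A + A') with hp
  set q := 2 * A / (A - A') with hq
  have hp0 : 0 < p := by positivity
  have hq0 : 0 < q := by positivity
  set ϰ := A / (4 * q * τ) with hϰ
  have hϰ0 : 0 < ϰ := by positivity
  have hpA : p * A' < A := by
    rw [hp, div_mul_eq_mul_div, div_lt_iff₀ (by positivity)]
    nlinarith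
  -- `ρ < 1` bounds the exponents that must stay below `r` relative to `r`, and `1 + α` is chosen so
  -- that `(1 + α) ρ < 1` still holds
  set ρ := max (max (1 - ϰ * δ / A) (p * A' / A)) (1 / 2) with hρ
  have hρ1 : ρ < 1 := by
    refine max_lt (max_lt ?_ ((div_lt_one hA).2 hpA)) (by norm_num)
    have : 0 < ϰ * δ / A := by positivity
    linarith
  have hρ0 : 1 / 2 ≤ ρ := le_max_right _ _
  have hρa : 1 - ϰ * δ / A ≤ ρ := (le_max_left _ _).trans (le_max_left _ _)
  have hρb : p * A' / A ≤ ρ := (le_max_right _ _).trans (le_max_left _ _)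
  set α := (1 - ρ) / 2 with hα
  have hα0 : 0 < α := by rw [hα]; linarith
  have hθ : 0 < (1 + α) * (r / A) := by positivity
  refine ⟨p, q, ϰ, (1 + α) * (r / A), (1 + α) * ρ * r, hp0, hq0, ?_, hϰ0, ?_, by positivity,
    ?_, ?_, ?_, ?_⟩
  · rw [hp, hq]
    field_simp
    ring
  · have : 0 < r / A := by positivity
    nlinarith
  · have h1 : (1 + α) * ρ < 1 := by rw [hα]; nlinarith
    nlinarith
  · have h1 : (1 + α) * (r / A) * (A - ϰ * δ) = (1 + α) * (1 - ϰ * δ / A) * r := by field_simp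
    rw [h1]
    gcongr
  · have h1 : p * ((1 + α) * (r / A)) * A' = (1 + α) * (p * A' / A) * r := by field_simp
    rw [h1]
    gcongr
  · have h1 : q * ((1 + α) * (r / A)) * ϰ * τ = (1 + α) * (1 / 4) * r := by
      rw [hϰ]; field_simp
    rw [h1]
    gcongr
    linarith

theorem exp_add_le_exp_mul_add_exp_mul {p q : ℝ} (hp : 0 < p) (hq : 0 < q)
    (hpq : 1 / p + 1 / q = 1) (x y : ℝ) :
    Real.exp (x + y) ≤ Real.exp (p * x) + Real.exp (q * y) := by
  have h := convexOn_exp.2 (Set.mem_univ (p * x)) (Set.mem_univ (q * y))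
    (by positivity : 0 ≤ 1 / p) (by positivity : 0 ≤ 1 / q) hpq
  have h1 : (1 / p) • (p * x) + (1 / q) • (q * y) = x + y := by
    simp only [smul_eq_mul]; field_simp
  rw [h1, smul_eq_mul, smul_eq_mul] at h
  have hp1 : 1 / p ≤ 1 := by have : 0 < 1 / q := by positivity
                             linarith
  have hq1 : 1 / q ≤ 1 := by have : 0 < 1 / p := by positivity
                             linarith
  refine h.trans (add_le_add ?_ ?_)
  · exact mul_le_of_le_one_left (Real.exp_pos _).le hp1
  · exact mul_le_of_le_one_left (Real.exp_pos _).le hq1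

variable {𝕜 : Type*} [RCLike 𝕜] {Ω : Type*} [MeasurableSpace Ω] {P : Measure Ω}
  {ι κ : Type*} [Countable κ] {t : ι → Ω → 𝕜}
  {H : Type*} [NormedAddCommGroup H] [InnerProductSpace 𝕜 H]
  {C : H →L[𝕜] H} {b : HilbertBasis κ 𝕜 H} {μ : κ → ℝ} {e : HilbertBasis ι 𝕜 H}

/-- The exponential weight `exp (θ (Q - c S + ϰ ‖y‖²))` to which the exponential Chebyshev
inequality is applied, with the value `Q` of the quadratic form, `S = ∑ |t n|²` over the extremal
indices and the residual field `y`. -/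
noncomputable def tiltedWeight (θ c ϰ Q S : ℝ) (y : H) : ℝ≥0∞ :=
  ENNReal.ofReal (Real.exp (θ * (Q - c * S + ϰ * ‖y‖ ^ 2)))

theorem tendsto_tiltedWeight (θ c ϰ S : ℝ) {x : ℕ → ℝ} {y : ℕ → H} {x' : ℝ} {y' : H}
    (hx : Tendsto x atTop (𝓝 x')) (hy : Tendsto y atTop (𝓝 y')) :
    Tendsto (fun j => tiltedWeight θ c ϰ (x j) S (y j)) atTop (𝓝 (tiltedWeight θ c ϰ x' S y')) := by
  have h := (((hx.sub_const (c * S)).add ((hy.norm.pow 2).const_mul ϰ)).const_mul θ)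
  exact ENNReal.tendsto_ofReal ((Real.continuous_exp.tendsto _).comp h)

/-- The exponential moment of a partial sum factorises, by independence of the variables inside and
outside the extremal set `E`. -/
theorem lintegral_tiltedWeight_eq (hi : iIndepFun t P) (htm : ∀ n, Measurable (t n)) {a : ι → ℝ}
    {A θ c ϰ : ℝ} {E U T : Finset ι} (hE : ∀ n ∈ E, a n = A) (hd : Disjoint E T)
    (hU : E.disjUnion T hd = U) :
    ∫⁻ ω, tiltedWeight θ c ϰ (∑ n ∈ U, a n * ‖t n ω‖ ^ 2)
      (∑ n ∈ E, ‖t n ω‖ ^ 2) (∑ n ∈ U, t n ω • posSqrt C (e n) -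
        ∑ n ∈ E, t n ω • posSqrt C (e n)) ∂P =
    (∫⁻ ω, ENNReal.ofReal (Real.exp (∑ n ∈ E, θ * (A - c) * ‖t n ω‖ ^ 2)) ∂P) *
      ∫⁻ ω, ENNReal.ofReal (Real.exp (θ * (∑ n ∈ T, a n * ‖t n ω‖ ^ 2 +
        ϰ * ‖∑ n ∈ T, t n ω • posSqrt C (e n)‖ ^ 2))) ∂P := by
  have hmE : Measurable fun x : E → 𝕜 =>
      ENNReal.ofReal (Real.exp (∑ n, θ * (A - c) * ‖x n‖ ^ 2)) := by fun_prop
  have hmT : Measurable fun x : T → 𝕜 =>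
      ENNReal.ofReal (Real.exp (θ * (∑ n : T, a n * ‖x n‖ ^ 2 +
        ϰ * ‖∑ n : T, x n • posSqrt C (e n)‖ ^ 2))) := by
    refine (ENNReal.continuous_ofReal.comp (f := fun x : T → 𝕜 =>
      Real.exp (θ * (∑ n : T, a n * ‖x n‖ ^ 2 +
        ϰ * ‖∑ n : T, x n • posSqrt C (e n)‖ ^ 2))) ?_).measurable
    fun_prop
  have hind := (hi.indepFun_finset E T hd htm).comp hmE hmT
  have hprod := lintegral_mul_eq_lintegral_mul_lintegral_of_indepFun''
    (hmE.comp (measurable_pi_lambda (fun ω (i : E) => t i ω) fun i => htm i)).aemeasurable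
    (hmT.comp (measurable_pi_lambda (fun ω (i : T) => t i ω) fun i => htm i)).aemeasurable hind
  have hs1 := fun ω => Finset.sum_coe_sort E fun n => θ * (A - c) * ‖t n ω‖ ^ 2
  have hs2 := fun ω => Finset.sum_coe_sort T fun n => a n * ‖t n ω‖ ^ 2
  have hs3 := fun ω => Finset.sum_coe_sort T fun n => t n ω • posSqrt C (e n)
  simp only [Function.comp_apply, hs1, hs2, hs3] at hprod
  rw [← hprod]
  refine lintegral_congr fun ω => ?_
  have hEs : ∑ n ∈ E, a n * ‖t n ω‖ ^ 2 = A * ∑ n ∈ E, ‖t n ω‖ ^ 2 := by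
    rw [Finset.mul_sum]
    exact Finset.sum_congr rfl fun n hn => by rw [hE n hn]
  rw [tiltedWeight, ← ENNReal.ofReal_mul (Real.exp_pos _).le, ← Real.exp_add, ← hU,
    Finset.sum_disjUnion, Finset.sum_disjUnion, add_sub_cancel_left, hEs, ← Finset.mul_sum]
  refine congrArg (fun x => ENNReal.ofReal (Real.exp x)) ?_
  ring

variable [IsProbabilityMeasure P] [CompleteSpace H]

theorem lintegral_exp_residual_le (hC : IsEigenbasis C b μ) (hμ : ∀ n, 0 < μ n) {τ : ℝ}
    (hτ : HasSum μ τ) (hτ0 : 0 < τ) (ht : ∀ n, IsStdGaussian P (t n)) (hi : iIndepFun t P)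
    (htm : ∀ n, Measurable (t n)) {a : ι → ℝ} (ha : Summable fun n => |a n|)
    {p q ϰ θ x₀ : ℝ} (hp : 0 < p) (hq : 0 < q) (hpq : 1 / p + 1 / q = 1) (hϰ : 0 < ϰ)
    (hθ : 0 < θ) (hx₀ : 0 < x₀) (hlt : 2 * reVar 𝕜 * x₀ < 1) (hx : q * θ * ϰ * τ ≤ x₀)
    {T : Finset ι} (hT : ∀ n ∈ T, p * θ * a n ≤ x₀) :
    ∫⁻ ω, ENNReal.ofReal (Real.exp (θ *
      (∑ n ∈ T, a n * ‖t n ω‖ ^ 2 + ϰ * ‖∑ n ∈ T, t n ω • posSqrt C (e n)‖ ^ 2))) ∂P ≤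
      ENNReal.ofReal (Real.exp ((p * θ * ∑' n, |a n|) *
        ((expSqMoment (reVar 𝕜) x₀ ^ 2).toReal / x₀))) + expSqMoment (reVar 𝕜) x₀ ^ 2 := by
  have hb1 := lintegral_exp_sum_le (a := fun n => p * θ * a n) (s := T) ht hi htm hx₀ hlt hT
  have hb2 := lintegral_exp_norm_sq_le (e := e) hC hμ hτ hτ0 ht hi (γ := q * θ * ϰ)
    (by positivity) hx T
  have hm : Measurable fun ω =>
      ENNReal.ofReal (Real.exp (∑ n ∈ T, p * θ * a n * ‖t n ω‖ ^ 2)) := by fun_prop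
  refine le_trans ?_ (add_le_add (hb1.trans ?_) hb2)
  · rw [← lintegral_add_left hm]
    refine lintegral_mono fun ω => ?_
    rw [← ENNReal.ofReal_add (Real.exp_pos _).le (Real.exp_pos _).le]
    refine ENNReal.ofReal_le_ofReal ?_
    have := exp_add_le_exp_mul_add_exp_mul hp hq hpq (θ * ∑ n ∈ T, a n * ‖t n ω‖ ^ 2)
      (θ * (ϰ * ‖∑ n ∈ T, t n ω • posSqrt C (e n)‖ ^ 2))
    convert! this using 2
    · ring
    · rw [← mul_assoc, Finset.mul_sum]
      simp_rw [mul_assoc]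
    · ring_nf
  · refine ENNReal.ofReal_le_ofReal (Real.exp_le_exp.2 (mul_le_mul_of_nonneg_right ?_
      (div_nonneg ENNReal.toReal_nonneg hx₀.le)))
    simp_rw [abs_mul, abs_of_pos hp, abs_of_pos hθ]
    rw [← Finset.mul_sum]
    exact mul_le_mul_of_nonneg_left (ha.sum_le_tsum _ fun n _ => abs_nonneg _) (by positivity)

/-- The exponential Chebyshev bound for large values of the quadratic form `Q = ∑ a n |t n|²` on the
event that the energy of the residual field `φ - φ̄` is not small compared with that of the extremal
component: the decay rate is strictly better than that of `P (Q > u)`. -/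
theorem exists_measure_le_exp (hC : IsEigenbasis C b μ) (hμ : ∀ n, 0 < μ n) {τ : ℝ}
    (hτ : HasSum μ τ) (hτ0 : 0 < τ) (ht : ∀ n, IsStdGaussian P (t n)) (hi : iIndepFun t P)
    (htm : ∀ n, Measurable (t n)) {a : ι → ℝ} (ha : Summable fun n => |a n|) {E : Finset ι}
    {A A' : ℝ} (hA' : 0 ≤ A') (hAA' : A' < A) (hE : ∀ n ∈ E, a n = A) (hE' : ∀ n ∉ E, a n ≤ A')
    {δ : ℝ} (hδ : 0 < δ) {φ : Ω → H} {s : ℕ → Finset ι} (hs : Tendsto s atTop atTop)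
    (hφ : ∀ᵐ ω ∂P, Tendsto (fun k => ∑ n ∈ s k, t n ω • posSqrt C (e n)) atTop (𝓝 (φ ω)))
    {Q : Ω → ℝ} (hQ : ∀ᵐ ω ∂P, HasSum (fun n => a n * ‖t n ω‖ ^ 2) (Q ω)) :
    ∃ θ : ℝ, 1 / (2 * reVar 𝕜) / A < θ ∧ ∃ K : ℝ≥0∞, K ≠ ∞ ∧ ∀ u : ℝ,
      P {ω | u < Q ω ∧ δ * ∑ n ∈ E, ‖t n ω‖ ^ 2 ≤
        ‖φ ω - ∑ n ∈ E, t n ω • posSqrt C (e n)‖ ^ 2} ≤ K * ENNReal.ofReal (Real.exp (-θ * u)) := by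
  classical
  have hr : (0 : ℝ) < reVar 𝕜 := reVar_pos (𝕜 := 𝕜)
  obtain ⟨p, q, ϰ, θ, x₀, hp, hq, hpq, hϰ, hθ, hx0, hxr, h1, h2, h3⟩ :=
    exists_chernoff_parameters (r := 1 / (2 * reVar 𝕜)) (by positivity) hA' hAA' hδ hτ0
  have hA : 0 < A := hA'.trans_lt hAA'
  have hθ0 : 0 < θ := lt_trans (by positivity) hθ
  have hlt : 2 * reVar 𝕜 * x₀ < 1 := by
    rw [lt_div_iff₀ (by positivity)] at hxr
    linarith
  set k := (expSqMoment (reVar 𝕜) x₀ ^ 2).toReal / x₀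
  set K : ℝ≥0∞ := ENNReal.ofReal (Real.exp ((∑ n ∈ E, |θ * (A - ϰ * δ)|) * k)) *
    (ENNReal.ofReal (Real.exp ((p * θ * ∑' n, |a n|) * k)) + expSqMoment (reVar 𝕜) x₀ ^ 2)
  have hKtop : K ≠ ∞ := ENNReal.mul_ne_top ENNReal.ofReal_ne_top
    (ENNReal.add_ne_top.2 ⟨ENNReal.ofReal_ne_top,
      ENNReal.pow_ne_top (expSqMoment_lt_top reVar_pos hlt).ne⟩)
  let S : Ω → ℝ := fun ω => ∑ n ∈ E, ‖t n ω‖ ^ 2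
  let y : Finset ι → Ω → H := fun U ω => ∑ n ∈ U, t n ω • posSqrt C (e n)
  let F : ℕ → Ω → ℝ≥0∞ := fun j ω => tiltedWeight θ (ϰ * δ) ϰ
    (∑ n ∈ s j, a n * ‖t n ω‖ ^ 2) (S ω) (y (s j) ω - y E ω)
  let G : Ω → ℝ≥0∞ := fun ω => tiltedWeight θ (ϰ * δ) ϰ (Q ω) (S ω) (φ ω - y E ω)
  have hpart : ∀ᶠ j in atTop, ∫⁻ ω, F j ω ∂P ≤ K := by
    filter_upwards [hs.eventually_ge_atTop E] with j hj
    have hd : Disjoint E (s j \ E) := Finset.disjoint_sdiff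
    refine (lintegral_tiltedWeight_eq hi htm hE hd (by
      rw [Finset.disjUnion_eq_union, Finset.union_sdiff_of_subset hj])).trans_le
      (mul_le_mul' ?_ ?_)
    · -- the penalty `ϰ δ S` makes the exponential moment of the extremal modes finite
      exact lintegral_exp_sum_le (a := fun _ => θ * (A - ϰ * δ)) ht hi htm hx0 hlt fun _ _ => h1
    · refine lintegral_exp_residual_le hC hμ hτ hτ0 ht hi htm ha hp hq hpq hϰ hθ0 hx0 hlt h3
        fun n hn => (mul_le_mul_of_nonneg_left
          (hE' n (Finset.disjoint_right.1 hd hn)) (by positivity)).trans h2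
  have hFlim : ∀ᵐ ω ∂P, Tendsto (fun j => F j ω) atTop (𝓝 (G ω)) := by
    filter_upwards [hφ, hQ] with ω h1 h2
    have h2' : Tendsto (fun j => ∑ n ∈ s j, a n * ‖t n ω‖ ^ 2) atTop (𝓝 (Q ω)) := h2.comp hs
    exact tendsto_tiltedWeight _ _ _ _ h2' (h1.sub_const (y E ω))
  have hFm : ∀ j, AEMeasurable (F j) P := fun j => by
    have hy : ∀ U : Finset ι, StronglyMeasurable (y U) := fun U =>
      Finset.stronglyMeasurable_fun_sum _ fun n _ => (htm n).stronglyMeasurable.smul_const _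
    have hn := ((hy (s j)).sub (hy E)).norm.measurable
    simp only [Pi.sub_apply] at hn
    simp only [F, S, tiltedWeight]
    fun_prop
  have hFint : ∫⁻ ω, G ω ∂P ≤ K := by
    -- Fatou's lemma along the partial sums
    rw [lintegral_congr_ae (hFlim.mono fun ω hω => hω.liminf_eq.symm)]
    exact (lintegral_liminf_le' hFm).trans (liminf_le_of_frequently_le' hpart.frequently)
  refine ⟨θ, hθ, K, hKtop, fun u => ?_⟩
  have hmark := mul_meas_ge_le_lintegral₀ (aemeasurable_of_tendsto_metrizable_ae atTop hFm hFlim)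
    (ENNReal.ofReal (Real.exp (θ * u)))
  have hsub : {ω | u < Q ω ∧ δ * S ω ≤ ‖φ ω - y E ω‖ ^ 2} ⊆
      {ω | ENNReal.ofReal (Real.exp (θ * u)) ≤ G ω} := by
    rintro ω ⟨hu, hD⟩
    refine ENNReal.ofReal_le_ofReal (Real.exp_le_exp.2 (mul_le_mul_of_nonneg_left ?_ hθ0.le))
    nlinarith
  change P {ω | u < Q ω ∧ δ * S ω ≤ ‖φ ω - y E ω‖ ^ 2} ≤ _
  calc _ = ENNReal.ofReal (Real.exp (θ * u)) * P {ω | u < Q ω ∧ δ * S ω ≤ ‖φ ω - y E ω‖ ^ 2} *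
        ENNReal.ofReal (Real.exp (-θ * u)) := by
        rw [mul_right_comm, ← ENNReal.ofReal_mul (Real.exp_pos _).le, ← Real.exp_add]
        simp
    _ ≤ _ := by
        gcongr
        exact (mul_le_mul_right (measure_mono hsub) _).trans (hmark.trans hFint)

end UpperBound

/-! ### The tail of the quadratic form, directions, extremal indices -/

section LowerBound

theorem measurable_tsum_ennreal {Ω : Type*} [MeasurableSpace Ω] {ι : Type*} [Countable ι]
    {f : ι → Ω → ℝ≥0∞} (hf : ∀ n, Measurable (f n)) : Measurable fun ω => ∑' n, f n ω :=
  Measurable.tsum hf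

variable {𝕜 : Type*} [RCLike 𝕜] {Ω : Type*} [MeasurableSpace Ω] {P : Measure Ω}
  [IsProbabilityMeasure P] {ι : Type*} [Countable ι] {t : ι → Ω → 𝕜}

/-- Lower bound for the tail of `Q = ∑ a n |t n|²`: a single extremal mode reaches a level slightly
above `u / A` while the independent remainder stays bounded. -/
theorem exists_le_measure_lt (ht : ∀ n, IsStdGaussian P (t n)) (hind : iIndepFun t P)
    (htm : ∀ n, Measurable (t n)) {a : ι → ℝ} (ha : Summable fun n => |a n|) {i : ι}
    (hi : 0 < a i) {Q : Ω → ℝ} (hQ : ∀ᵐ ω ∂P, HasSum (fun n => a n * ‖t n ω‖ ^ 2) (Q ω))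
    {η : ℝ} (hη : 0 < η) :
    ∃ c : ℝ, 0 < c ∧ ∀ u : ℝ, 0 ≤ u →
      ENNReal.ofReal (c * Real.exp (-((1 + η) * (1 / (2 * reVar 𝕜) / a i) * u))) ≤
        P {ω | u < Q ω} := by
  classical
  have hr : (0 : ℝ) < reVar 𝕜 := reVar_pos (𝕜 := 𝕜)
  let f : ι → Ω → ℝ≥0∞ := fun n ω => if n = i then 0 else ENNReal.ofReal (|a n| * ‖t n ω‖ ^ 2)
  let N : Ω → ℝ≥0∞ := fun ω => ∑' n, f n ω
  let m : ι → MeasurableSpace Ω := fun n => MeasurableSpace.comap (t n) inferInstance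
  have hm : ∀ n, m n ≤ ‹MeasurableSpace Ω› := fun n => (htm n).comap_le
  have hIndep := indep_iSup_of_disjoint hm hind.iIndep
    (disjoint_compl_right : Disjoint ({i} : Set ι) {i}ᶜ)
  have hNm' : Measurable[⨆ j ∈ ({i}ᶜ : Set ι), m j] N := by
    refine @measurable_tsum_ennreal Ω (⨆ j ∈ ({i}ᶜ : Set ι), m j) ι _ f fun n => ?_
    by_cases hn : n = i
    · simp only [f, hn, if_true]
      exact measurable_const
    · simp only [f, hn, if_false]
      have h1 : Measurable[⨆ j ∈ ({i}ᶜ : Set ι), m j] (t n) :=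
        Measurable.mono (comap_measurable (t n)) (le_iSup₂_of_le n hn le_rfl) le_rfl
      have h2 : Measurable fun z : 𝕜 => ENNReal.ofReal (|a n| * ‖z‖ ^ 2) := by fun_prop
      exact h2.comp h1
  have hNm : Measurable N := hNm'.mono (iSup₂_le fun j _ => hm j) le_rfl
  have hNtop : ∀ᵐ ω ∂P, N ω < ∞ := by
    refine ae_lt_top hNm (lt_of_le_of_lt (lintegral_mono fun ω => ?_)
      (lintegral_tsum_lt_top ht ha)).ne
    refine ENNReal.tsum_le_tsum fun n => ?_
    simp only [f]
    split_ifs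
    · exact zero_le
    · exact le_rfl
  obtain ⟨K, hK⟩ : ∃ K : ℕ, P {ω | N ω ≤ K} ≠ 0 := by
    by_contra! h
    have h1 : P (⋃ K : ℕ, {ω | N ω ≤ K}) = 0 := measure_iUnion_null h
    have h2 : ∀ᵐ ω ∂P, ω ∈ ⋃ K : ℕ, {ω | N ω ≤ K} := by
      filter_upwards [hNtop] with ω hω
      obtain ⟨K, hK⟩ := ENNReal.exists_nat_gt hω.ne
      exact Set.mem_iUnion.2 ⟨K, hK.le⟩
    have h3 : P Set.univ = 0 := by
      rw [← h1]
      exact measure_congr (eventuallyEq_univ.2 h2).symm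
    simp at h3
  obtain ⟨c, hc, hlow⟩ := (ht i).le_measure_norm_sq hη
  have hPK : 0 < (P {ω | N ω ≤ K}).toReal := ENNReal.toReal_pos hK (measure_ne_top _ _)
  refine ⟨c * Real.exp (-((1 + η) * (1 / (2 * reVar 𝕜) / a i) * K)) *
    (P {ω | N ω ≤ K}).toReal, by positivity, fun u hu => ?_⟩
  have hprod := (Indep_iff _ _ _).1 hIndep {ω | (u + K) / a i < ‖t i ω‖ ^ 2} {ω | N ω ≤ K}
    (by
      have h1 : Measurable[⨆ j ∈ ({i} : Set ι), m j] (t i) :=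
        Measurable.mono (comap_measurable (t i)) (le_iSup₂_of_le i rfl le_rfl) le_rfl
      have h2 : MeasurableSet {z : 𝕜 | (u + K) / a i < ‖z‖ ^ 2} :=
        measurableSet_lt (by fun_prop) (by fun_prop)
      exact h1 h2)
    (hNm' measurableSet_Iic)
  calc _ = ENNReal.ofReal (c * Real.exp (-((1 + η) * ((u + K) / a i) / (2 * reVar 𝕜)))) *
        P {ω | N ω ≤ K} := by
        rw [← ENNReal.ofReal_toReal (measure_ne_top P {ω | N ω ≤ K}),
          ← ENNReal.ofReal_mul (by positivity)]
        congr 1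
        rw [ENNReal.toReal_ofReal hPK.le, mul_right_comm, mul_assoc c, ← Real.exp_add]
        congr 3
        field_simp
        ring
    _ ≤ P {ω | (u + K) / a i < ‖t i ω‖ ^ 2} * P {ω | N ω ≤ K} := by
        gcongr
        exact hlow _ (by positivity)
    _ ≤ P {ω | u < Q ω} := by
        rw [← hprod]
        refine measure_mono_ae ?_
        filter_upwards [hQ] with ω hω hmem
        obtain ⟨h1, h2⟩ : (u + K) / a i < ‖t i ω‖ ^ 2 ∧ N ω ≤ K := hmem
        change u < Q ω
        rw [div_lt_iff₀ hi] at h1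
        have hNs := ENNReal.summable_toReal (ne_top_of_le_ne_top (ENNReal.natCast_ne_top K) h2)
        have hNle : ∑' n, (f n ω).toReal ≤ K := by
          rw [← ENNReal.tsum_toReal_eq fun n => by
              simp only [f]
              split_ifs <;> first | exact ENNReal.zero_ne_top | exact ENNReal.ofReal_ne_top]
          exact ENNReal.toReal_le_of_le_ofReal (Nat.cast_nonneg K) (by simpa using h2)
        have hrest : HasSum (fun n => a n * ‖t n ω‖ ^ 2 -
            if n = i then a i * ‖t i ω‖ ^ 2 else 0) (Q ω - a i * ‖t i ω‖ ^ 2) :=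
          hω.sub (hasSum_ite_eq i _)
        have hneg := hasSum_le (fun n => ?_) hNs.hasSum.neg hrest
        · linarith
        · simp only [f]
          by_cases hn : n = i
          · simp [hn]
          · simp only [hn, if_false, sub_zero]
            rw [ENNReal.toReal_ofReal (by positivity), ← neg_mul]
            exact mul_le_mul_of_nonneg_right (neg_abs_le _) (sq_nonneg _)

end LowerBound

section Directions

variable {𝕜 : Type*} [RCLike 𝕜] {H : Type*} [NormedAddCommGroup H] [InnerProductSpace 𝕜 H]

theorem norm_unitVec_sub_mul_le (x y : H) :
    ‖unitVec 𝕜 x - unitVec 𝕜 y‖ * ‖y‖ ≤ 2 * ‖x - y‖ := by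
  rcases eq_or_ne x 0 with rfl | hx
  · rcases eq_or_ne y 0 with rfl | hy
    · simp
    · have : ‖y‖ ≠ 0 := norm_ne_zero_iff.2 hy
      simp [unitVec, norm_smul, this]
      linarith [norm_nonneg y]
  · have hx' : 0 < ‖x‖ := norm_pos_iff.2 hx
    have h : ((‖y‖ : ℝ) : 𝕜) • (unitVec 𝕜 x - unitVec 𝕜 y) =
        (((‖y‖ - ‖x‖) * ‖x‖⁻¹ : ℝ) : 𝕜) • x + (x - y) := by
      have h1 : ((‖y‖ : ℝ) : 𝕜) • unitVec 𝕜 y = y := by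
        rcases eq_or_ne y 0 with rfl | hy
        · simp [unitVec]
        · rw [unitVec, smul_smul, ← RCLike.ofReal_mul, mul_inv_cancel₀ (norm_ne_zero_iff.2 hy)]
          simp
      have h2 : (((‖y‖ - ‖x‖) * ‖x‖⁻¹ : ℝ) : 𝕜) • x =
          ((‖y‖ : ℝ) : 𝕜) • unitVec 𝕜 x - x := by
        rw [sub_mul, mul_inv_cancel₀ hx'.ne', unitVec, smul_smul, ← RCLike.ofReal_mul]
        push_cast
        rw [sub_smul, one_smul]
      rw [smul_sub, h1, h2]
      abel
    calc ‖unitVec 𝕜 x - unitVec 𝕜 y‖ * ‖y‖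
        = ‖((‖y‖ : ℝ) : 𝕜) • (unitVec 𝕜 x - unitVec 𝕜 y)‖ := by
          rw [norm_smul, RCLike.norm_ofReal, abs_norm, mul_comm]
      _ ≤ ‖(((‖y‖ - ‖x‖) * ‖x‖⁻¹ : ℝ) : 𝕜) • x‖ + ‖x - y‖ := by
          rw [h]
          exact norm_add_le _ _
      _ = |‖y‖ - ‖x‖| + ‖x - y‖ := by
          rw [norm_smul, RCLike.norm_ofReal, abs_mul, abs_of_pos (inv_pos.2 hx'), mul_assoc,
            inv_mul_cancel₀ hx'.ne', mul_one]
      _ ≤ 2 * ‖x - y‖ := by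
          have := abs_norm_sub_norm_le y x
          rw [norm_sub_rev] at this
          linarith

/-- On the span of finitely many vectors `C^{1/2} e n` the norm controls the coefficients. -/
theorem exists_le_norm_sum_sq {ι : Type*} {e : ι → H} (he : Orthonormal 𝕜 e) {R : H →L[𝕜] H}
    (hR : Function.Injective R) (E : Finset ι) :
    ∃ c : ℝ, 0 < c ∧ ∀ z : ι → 𝕜, c * ∑ n ∈ E, ‖z n‖ ^ 2 ≤ ‖∑ n ∈ E, z n • R (e n)‖ ^ 2 := by
  let V := Submodule.span 𝕜 (e '' E)
  have : FiniteDimensional 𝕜 V := FiniteDimensional.span_of_finite 𝕜 (E.finite_toSet.image e)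
  obtain ⟨K, hK, hKl⟩ := ((R : H →ₗ[𝕜] H).comp V.subtype).exists_antilipschitzWith
    (LinearMap.ker_eq_bot.2 (hR.comp V.injective_subtype))
  have hK' : (0 : ℝ) < K := hK
  refine ⟨((K : ℝ) ^ 2)⁻¹, by positivity, fun z => ?_⟩
  have hmem : ∑ n ∈ E, z n • e n ∈ V := Submodule.sum_mem _ fun n hn =>
    Submodule.smul_mem _ _ (Submodule.subset_span ⟨n, hn, rfl⟩)
  have h := hKl.le_mul_dist ⟨∑ n ∈ E, z n • e n, hmem⟩ 0
  rw [map_zero, dist_zero_right, dist_zero_right] at h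
  have h2 : ((R : H →ₗ[𝕜] H).comp V.subtype) ⟨∑ n ∈ E, z n • e n, hmem⟩ =
      ∑ n ∈ E, z n • R (e n) := by
    simp
  rw [h2] at h
  rw [← norm_sum_smul_sq he, inv_mul_le_iff₀ (by positivity), ← mul_pow]
  exact pow_le_pow_left₀ (norm_nonneg _) h 2

end Directions

section Extremal

variable {ι : Type*} {lam : ι → ℝ} {σ : ℝ}

theorem finite_setOf_le_of_summable_abs {a : ι → ℝ} (ha : Summable fun n => |a n|) {x : ℝ}
    (hx : 0 < x) : {j | x ≤ a j}.Finite := by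
  have := ha.tendsto_cofinite_zero.eventually (gt_mem_nhds hx)
  refine Set.Finite.subset (Filter.eventually_cofinite.1 this) fun j hj => ?_
  exact not_lt.2 (le_trans hj (le_abs_self _))

theorem extremal_finite_nonempty (hl : Summable fun n => |σ * lam n|) (h : ∃ i, 0 < σ * lam i) :
    (extremal lam σ).Finite ∧ (extremal lam σ).Nonempty := by
  obtain ⟨i, hi⟩ := h
  have hfin := finite_setOf_le_of_summable_abs hl hi
  refine ⟨hfin.subset fun j hj => hj.2 i, ?_⟩
  have hi' : i ∈ {j | σ * lam i ≤ σ * lam j} := le_refl (σ * lam i)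
  obtain ⟨j, hj, hmax⟩ := Set.exists_max_image _ (fun j => σ * lam j) hfin ⟨i, hi'⟩
  refine ⟨j, lt_of_lt_of_le hi hj, fun k => ?_⟩
  rcases le_total (σ * lam i) (σ * lam k) with hk | hk
  · exact hmax k hk
  · exact le_trans hk hj

/-- The gap between the largest value of `σ lam` and its values off the extremal set. -/
theorem exists_lt_of_notMem_extremal (hl : Summable fun n => |σ * lam n|) {i : ι}
    (hi : i ∈ extremal lam σ) :
    ∃ A' : ℝ, 0 ≤ A' ∧ A' < σ * lam i ∧ ∀ n ∉ extremal lam σ, σ * lam n ≤ A' := by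
  have hfin := finite_setOf_le_of_summable_abs hl (half_pos hi.1)
  classical
  set T := hfin.toFinset.filter fun n => n ∉ extremal lam σ
  have hlt : ∀ n ∉ extremal lam σ, σ * lam n < σ * lam i := fun n hn => by
    refine lt_of_le_of_ne (hi.2 n) fun heq => hn ⟨heq ▸ hi.1, fun j => heq ▸ hi.2 j⟩
  have hne : (insert (σ * lam i / 2) (T.image fun n => σ * lam n)).Nonempty :=
    Finset.insert_nonempty _ _
  refine ⟨Finset.max' _ hne, ?_, ?_, fun n hn => ?_⟩
  · exact (half_pos hi.1).le.trans (Finset.le_max' _ _ (Finset.mem_insert_self _ _))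
  · refine (Finset.max'_lt_iff _ hne).2 fun x hx => ?_
    rcases Finset.mem_insert.1 hx with rfl | hx
    · exact half_lt_self hi.1
    · obtain ⟨n, hn, rfl⟩ := Finset.mem_image.1 hx
      exact hlt n (Finset.mem_filter.1 hn).2
  · rcases le_total (σ * lam i / 2) (σ * lam n) with h | h
    · have hnT : n ∈ T := by
        rw [Finset.mem_filter, hfin.mem_toFinset]
        exact ⟨h, hn⟩
      have hmem : σ * lam n ∈ insert (σ * lam i / 2) (T.image fun n => σ * lam n) :=
        Finset.mem_insert_of_mem (Finset.mem_image_of_mem (fun n => σ * lam n) hnT)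
      exact Finset.le_max' _ _ hmem
    · exact h.trans (Finset.le_max' _ _ (Finset.mem_insert_self _ _))

end Extremal

/-! ### Conditioning on large values -/

section Conditioning

variable {𝕜 : Type*} [RCLike 𝕜] {Ω : Type*} [MeasurableSpace Ω] {P : Measure Ω}
  {ι κ : Type*} [Countable ι] [Countable κ] {t : ι → Ω → 𝕜}
  {H : Type*} [NormedAddCommGroup H] [InnerProductSpace 𝕜 H] [CompleteSpace H]
  {C : H →L[𝕜] H} {b : HilbertBasis κ 𝕜 H} {μ : κ → ℝ} {e : HilbertBasis ι 𝕜 H}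

/-- An event is asymptotically negligible given `Q > u` once `P (Q > u, B)` decays exponentially
faster than `P (Q > u)`. -/
theorem tendsto_cond_of_exponential_bounds {Q : Ω → ℝ} (hQm : AEMeasurable Q P) {B : Set Ω}
    {θ ρ c : ℝ} {K : ℝ≥0∞} (hK : K ≠ ∞) (hc : 0 < c) (hρθ : ρ < θ)
    (hup : ∀ u, P ({ω | u < Q ω} ∩ B) ≤ K * ENNReal.ofReal (Real.exp (-θ * u)))
    (hlow : ∀ u, 0 ≤ u → ENNReal.ofReal (c * Real.exp (-(ρ * u))) ≤ P {ω | u < Q ω}) :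
    Tendsto (fun u : ℝ => P[|{ω | u < Q ω}] B) atTop (𝓝 0) := by
  have hbound : ∀ u : ℝ, 0 ≤ u → P[|{ω | u < Q ω}] B ≤
      K * ENNReal.ofReal (c⁻¹ * Real.exp (-((θ - ρ) * u))) := by
    intro u hu
    have hm : NullMeasurableSet {ω | u < Q ω} P :=
      nullMeasurableSet_lt aemeasurable_const hQm
    rw [ProbabilityTheory.cond, Measure.smul_apply, smul_eq_mul, Measure.restrict_apply₀' hm,
      Set.inter_comm]
    calc _ ≤ (ENNReal.ofReal (c * Real.exp (-(ρ * u))))⁻¹ *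
          (K * ENNReal.ofReal (Real.exp (-θ * u))) :=
          mul_le_mul' (ENNReal.inv_le_inv.2 (hlow u hu)) (hup u)
      _ = _ := by
          rw [← ENNReal.ofReal_inv_of_pos (by positivity), mul_left_comm,
            ← ENNReal.ofReal_mul (by positivity), mul_inv, ← Real.exp_neg, mul_assoc,
            ← Real.exp_add]
          ring_nf
  have hlim : Tendsto (fun u : ℝ => K * ENNReal.ofReal (c⁻¹ * Real.exp (-((θ - ρ) * u)))) atTop
      (𝓝 0) := by
    have h1 : Tendsto (fun u : ℝ => c⁻¹ * Real.exp (-((θ - ρ) * u))) atTop (𝓝 0) := by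
      have h2 := Real.tendsto_exp_neg_atTop_nhds_zero.comp
        (tendsto_id.const_mul_atTop (sub_pos.2 hρθ))
      simpa using h2.const_mul c⁻¹
    simpa using ENNReal.Tendsto.const_mul (ENNReal.tendsto_ofReal h1) (Or.inr hK)
  refine tendsto_of_tendsto_of_tendsto_of_le_of_le' tendsto_const_nhds hlim
    (Eventually.of_forall fun _ => zero_le) ?_
  filter_upwards [eventually_ge_atTop 0] with u hu
  exact hbound u hu

variable [IsProbabilityMeasure P]

/-- The large deviation statement for the random form `Q = ∑ a n |t n|²` with `a = σ lam`. -/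
theorem tail_pos_and_tendsto_cond (hC : IsEigenbasis C b μ) (hμ : ∀ n, 0 < μ n)
    (hsum : Summable μ) {φ : Ω → H} (hφ : AEStronglyMeasurable φ P)
    (ht : IsKarhunenLoeve P C φ e t) {lam : ι → ℝ} {σ : ℝ}
    (hl : Summable fun n => |σ * lam n|) (hpos : ∃ i, 0 < σ * lam i) {Q : Ω → ℝ}
    (hQ : ∀ᵐ ω ∂P, HasSum (fun n => σ * lam n * ‖t n ω‖ ^ 2) (Q ω)) :
    (∀ u : ℝ, P {ω | u < Q ω} ≠ 0) ∧ ∀ ε : ℝ, 0 < ε →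
      Tendsto (fun u : ℝ => P[|{ω | u < Q ω}]
        {ω | ε < ‖unitVec 𝕜 (φ ω) - unitVec 𝕜 (fieldBar C e lam t σ ω)‖}) atTop (𝓝 0) := by
  have hr : (0 : ℝ) < reVar 𝕜 := reVar_pos (𝕜 := 𝕜)
  obtain ⟨hfin, i, hi⟩ := extremal_finite_nonempty hl hpos
  obtain ⟨A', hA'0, hA'lt, hA'⟩ := exists_lt_of_notMem_extremal hl hi
  have hi0 : 0 < σ * lam i := hi.1
  -- replace the coefficients by measurable modifications
  let t' : ι → Ω → 𝕜 := fun n => (ht.1 n).1.mk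
  have htm : ∀ n, Measurable (t' n) := fun n => (ht.1 n).1.measurable_mk
  have hae : ∀ n, t n =ᵐ[P] t' n := fun n => (ht.1 n).1.ae_eq_mk
  have hall : ∀ᵐ ω ∂P, ∀ n, t n ω = t' n ω := ae_all_iff.2 hae
  have ht' : ∀ n, IsStdGaussian P (t' n) := fun n =>
    isStdGaussian_iff.2 ((isStdGaussian_iff.1 (ht.1 n)).congr (hae n))
  have hind : iIndepFun t' P := ht.2.1.congr hae
  have hQ' : ∀ᵐ ω ∂P, HasSum (fun n => σ * lam n * ‖t' n ω‖ ^ 2) (Q ω) := by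
    filter_upwards [hQ, hall] with ω h1 h2
    simpa only [h2] using h1
  obtain ⟨s, hs, hsae⟩ := ht.exists_seq_tendsto_ae hφ
  have hsae' : ∀ᵐ ω ∂P,
      Tendsto (fun k => ∑ n ∈ s k, t' n ω • posSqrt C (e n)) atTop (𝓝 (φ ω)) := by
    filter_upwards [hsae, hall] with ω h1 h2
    simpa only [h2] using h1
  have hQm : AEMeasurable Q P :=
    aemeasurable_of_tendsto_metrizable_ae atTop
      (f := fun k ω => ∑ n ∈ s k, σ * lam n * ‖t' n ω‖ ^ 2)
      (fun k => by
        have : Measurable fun ω => ∑ n ∈ s k, σ * lam n * ‖t' n ω‖ ^ 2 := by fun_prop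
        exact this.aemeasurable)
      (hQ'.mono fun ω hω => hω.comp hs)
  have hlow : ∀ η : ℝ, 0 < η → ∃ c : ℝ, 0 < c ∧ ∀ u : ℝ, 0 ≤ u →
      ENNReal.ofReal (c * Real.exp (-((1 + η) * (1 / (2 * reVar 𝕜) / (σ * lam i)) * u))) ≤
        P {ω | u < Q ω} := fun η hη =>
    exists_le_measure_lt (a := fun n => σ * lam n) ht' hind htm hl hi0 hQ' hη
  refine ⟨fun u hu => ?_, fun ε hε => ?_⟩
  · obtain ⟨c, hc, hcl⟩ := hlow 1 one_pos
    have h1 := hcl (max u 0) (le_max_right _ _)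
    have h2 : P {ω | max u 0 < Q ω} = 0 :=
      measure_mono_null (Set.ofPred_subset_ofPred.2 fun ω hω => (le_max_left u 0).trans_lt hω) hu
    rw [h2, nonpos_iff_eq_zero, ENNReal.ofReal_eq_zero] at h1
    exact absurd h1 (not_le.2 (by positivity))
  set E := hfin.toFinset
  have hμ0 : HasSum μ (∑' m, μ m) := hsum.hasSum
  have hτ0 : 0 < ∑' m, μ m := by
    obtain ⟨m⟩ : Nonempty κ := by
      by_contra hemp
      rw [not_nonempty_iff] at hemp
      have h0 : e i = 0 := hilbertBasis_ext b fun n => hemp.elim n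
      simpa [h0] using e.orthonormal.1 i
    exact hsum.tsum_pos (fun n => (hμ n).le) m (hμ m)
  obtain ⟨c₀, hc₀, hcE⟩ := exists_le_norm_sum_sq e.orthonormal (posSqrt_injective hC hμ) E
  obtain ⟨θ, hθ, K, hK, hup⟩ := exists_measure_le_exp (a := fun n => σ * lam n) (E := E)
    (A := σ * lam i) (δ := ε ^ 2 * c₀ / 4) hC hμ hμ0 hτ0 ht' hind htm hl hA'0 hA'lt
    (fun n hn => le_antisymm (hi.2 n) ((hfin.mem_toFinset.1 hn).2 i))
    (fun n hn => hA' n fun h => hn (hfin.mem_toFinset.2 h)) (by positivity) hs hsae' hQ'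
  set r := 1 / (2 * reVar 𝕜 : ℝ) / (σ * lam i) with hrdef
  have hr0 : 0 < r := by positivity
  -- `η` is such that the rate `(1 + η) r` of the lower bound is the midpoint of `r` and `θ`
  obtain ⟨c, hc, hcl⟩ := hlow ((θ / r - 1) / 2) (by
    have : 1 < θ / r := (one_lt_div hr0).2 hθ
    linarith)
  have hρθ : (1 + (θ / r - 1) / 2) * r < θ := by
    have : (1 + (θ / r - 1) / 2) * r = (r + θ) / 2 := by field_simp; ring
    rw [this]
    linarith
  refine tendsto_cond_of_exponential_bounds hQm hK hc hρθ (fun u => ?_) hcl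
  refine (measure_mono_ae ?_).trans (hup u)
  filter_upwards [hall] with ω hω hmem
  obtain ⟨h1, h2⟩ : u < Q ω ∧
    ε < ‖unitVec 𝕜 (φ ω) - unitVec 𝕜 (fieldBar C e lam t σ ω)‖ := hmem
  refine ⟨h1, ?_⟩
  have hbar : fieldBar C e lam t σ ω = ∑ n ∈ E, t' n ω • posSqrt C (e n) := by
    simp_rw [fieldBar, hω]
    exact finsum_mem_eq_finite_toFinset_sum _ hfin
  rw [hbar] at h2
  set y := ∑ n ∈ E, t' n ω • posSqrt C (e n)
  -- a deviation of the directions by `ε` forces `‖φ - φ̄‖ ≥ (ε / 2) ‖φ̄‖`, even where `φ̄ = 0`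
  have h3 := norm_unitVec_sub_mul_le (𝕜 := 𝕜) (φ ω) y
  have h4 : ε * ‖y‖ ≤ 2 * ‖φ ω - y‖ :=
    (mul_le_mul_of_nonneg_right h2.le (norm_nonneg _)).trans h3
  have h5 := pow_le_pow_left₀ (by positivity) h4 2
  have h6 := mul_le_mul_of_nonneg_left (hcE fun n => t' n ω) (sq_nonneg ε)
  change ε ^ 2 * c₀ / 4 * ∑ n ∈ E, ‖t' n ω‖ ^ 2 ≤ ‖φ ω - y‖ ^ 2
  have h7 : ε ^ 2 * (c₀ * ∑ n ∈ E, ‖t' n ω‖ ^ 2) ≤ ε ^ 2 * ‖y‖ ^ 2 := h6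
  nlinarith

end Conditioning

theorem separableSpace_fieldSpace (𝕜 : Type*) [RCLike 𝕜] {d : ℕ}
    (Λ : Set (EuclideanSpace ℝ (Fin d))) (N : ℕ) :
    TopologicalSpace.SeparableSpace (FieldSpace 𝕜 Λ N) := by
  have : Fact ((2 : ℝ≥0∞) ≠ ∞) := ⟨ENNReal.ofNat_ne_top⟩
  have : SecondCountableTopology (FieldSpace 𝕜 Λ N) := Lp.SecondCountableTopology
  infer_instance

end QuasiDet

theorem proposition1 {𝕜 : Type*} [RCLike 𝕜] {d N : ℕ}
    (Λ : Set (EuclideanSpace ℝ (Fin d))) (hΛ : Bornology.IsBounded Λ) (hΛm : MeasurableSet Λ)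
    -- the covariance operator `C = ∑ μ_n |μ_n⟩⟨μ_n|`, with all `μ_n > 0`
    (C : QuasiDet.FieldSpace 𝕜 Λ N →L[𝕜] QuasiDet.FieldSpace 𝕜 Λ N)
    {κ : Type*} (b : HilbertBasis κ 𝕜 (QuasiDet.FieldSpace 𝕜 Λ N)) (μ : κ → ℝ)
    (hμ : ∀ n, 0 < μ n) (hC : QuasiDet.IsEigenbasis C b μ) (hCtr : QuasiDet.IsTraceClass C)
    -- the Hermitian operator `O` and `M = C^{1/2} O C^{1/2}`
    (Φ : Submodule 𝕜 (QuasiDet.FieldSpace 𝕜 Λ N)) (hΦ : ∀ x, QuasiDet.posSqrt C x ∈ Φ)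
    (O : Φ →ₗ[𝕜] (Φ →ₗ⋆[𝕜] 𝕜)) (hO : QuasiDet.IsHermitianForm O)
    (M : QuasiDet.FieldSpace 𝕜 Λ N →L[𝕜] QuasiDet.FieldSpace 𝕜 Λ N)
    (hM : QuasiDet.IsSandwich C hΦ O M) (hMtr : QuasiDet.IsTraceClass M)
    {ι : Type*} (e : HilbertBasis ι 𝕜 (QuasiDet.FieldSpace 𝕜 Λ N)) (lam : ι → ℝ)
    (he : QuasiDet.IsEigenbasis M e lam)
    -- the Gaussian field
    {Ω : Type*} [MeasurableSpace Ω] (P : Measure Ω) [IsProbabilityMeasure P]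
    (φ : Ω → QuasiDet.FieldSpace 𝕜 Λ N) (hφ : QuasiDet.IsGaussianField P C φ) :
    (∃ t : ι → Ω → 𝕜, QuasiDet.IsKarhunenLoeve P C φ e t) ∧
    ∀ t : ι → Ω → 𝕜, QuasiDet.IsKarhunenLoeve P C φ e t →
      (∀ᵐ ω ∂P, Tendsto (fun s : Finset ι => QuasiDet.partialForm C hΦ O e t s ω) atTop
        (𝓝 (QuasiDet.quadForm C hΦ O e t ω))) ∧
      (∀ B : QuasiDet.FieldSpace 𝕜 Λ N →L[𝕜] QuasiDet.FieldSpace 𝕜 Λ N,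
        (∀ f g : Φ, O f g = inner 𝕜 (g : QuasiDet.FieldSpace 𝕜 Λ N) (B f)) →
        ∀ᵐ ω ∂P, QuasiDet.quadForm C hΦ O e t ω = RCLike.re (inner 𝕜 (φ ω) (B (φ ω)))) ∧
      ∀ σ : ℝ, (σ = 1 ∨ σ = -1) → (∃ i, 0 < σ * lam i) →
        (QuasiDet.extremal lam σ).Finite ∧ (QuasiDet.extremal lam σ).Nonempty ∧
        (∀ u : ℝ, P {ω | u < σ * QuasiDet.quadForm C hΦ O e t ω} ≠ 0) ∧
        ∀ ε : ℝ, 0 < ε →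
          Tendsto (fun u : ℝ =>
            (ProbabilityTheory.cond P {ω | u < σ * QuasiDet.quadForm C hΦ O e t ω})
              {ω | ε < ‖QuasiDet.unitVec 𝕜 (φ ω) -
                QuasiDet.unitVec 𝕜 (QuasiDet.fieldBar C e lam t σ ω)‖})
            atTop (𝓝 0) := by
  have := QuasiDet.separableSpace_fieldSpace 𝕜 Λ N
  have : Countable ι := QuasiDet.countable_of_hilbertBasis e
  have : Countable κ := QuasiDet.countable_of_hilbertBasis b
  have hsum : Summable μ := (hCtr.summable_abs hC).of_abs
  have hl : Summable fun n => |lam n| := hMtr.summable_abs he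
  refine ⟨hφ.exists_isKarhunenLoeve hC hμ hsum e, fun t ht => ?_⟩
  have hQ := QuasiDet.ae_hasSum_quadForm hM he ht.1 hl
  refine ⟨?_, fun B hB => QuasiDet.quadForm_eq_of_bounded hφ.1 ht hM he hl B hB,
    fun σ _ hpos => ?_⟩
  · filter_upwards [hQ] with ω hω
    simp_rw [QuasiDet.partialForm_eq hM he]
    exact hω
  · have hlσ : Summable fun n => |σ * lam n| := by
      simp_rw [abs_mul]
      exact hl.mul_left _
    obtain ⟨hfin, hne⟩ := QuasiDet.extremal_finite_nonempty hlσ hpos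
    have hQσ : ∀ᵐ ω ∂P, HasSum (fun n => σ * lam n * ‖t n ω‖ ^ 2)
        (σ * QuasiDet.quadForm C hΦ O e t ω) := by
      filter_upwards [hQ] with ω hω
      simpa only [mul_assoc] using hω.mul_left σ
    exact ⟨hfin, hne, QuasiDet.tail_pos_and_tendsto_cond hC hμ hsum hφ.1 ht hlσ hpos hQσ⟩
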